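/- **Setting.** Fix real numbers $0<\delta\le M$ (resolution and magnitude bound). A *looped neural network* consists of a state dimension $n\ge 3$ and a feedforward block $f_\theta:\mathbb R^n\to\mathbb R^n$, $f_\theta=A_L\circ\mathrm{ReLU}\circ A_{L-1}\circ\cdots\circ\mathrm{ReLU}\circ A_1$, with any number $L\ge1$ of affine layers $A_i(x)=W_ix+b_i$ of any hidden widths, and ReLU applied coordinatewise; $\theta$ is the vector of all entries of the $W_i$ and $b_i$, and $\|\theta\|_0$ is the number of its non-zero entries. The network has precision $(\delta,M)$, written $\theta\in\Theta_{\delta,M}$, if all entries of $\theta$ lie in $\delta\mathbb Z\cap[-M,M]$. It is run by $x_0=0$, $x_{t+1}=f_\theta(x_t)$, in exact real arithmetic. At each iteration $t\ge1$: if the first coordinate of $x_t$ is $>0$, the network halts; otherwise, if the second coordinate of $x_t$ is $>0$, the bit $\mathbf 1[(x_t)_3>0]$ is appended to the output. The network *outputs* $s\in\{0,1\}^*$ if it halts and the bits accumulated until then form $s$. The *neural complexity* of $s\in\{0,1\}^*$ is $$\mathcal N(s)=\inf\{\|\theta\|_0:\theta\in\Theta_{\delta,M},\ \theta\text{ outputs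 }s\}\in\mathbb N\cup\{\infty\},\qquad \inf\emptyset=\infty .$$ A function $F:\{0,1\}^*\to\mathbb N\cup\{\infty\}$ is *computable* if an algorithm computes $F(s)$ from $s$. It is *upper-semicomputable* if there is a computable $\varphi:\{0,1\}^*\times\mathbb N\to\mathbb N\cup\{\infty\}$ such that, for every $s$, $\varphi(s,k)$ is non-increasing in $k$ and $\lim_{k\to\infty}\varphi(s,k)=F(s)$. A real number $x$ is *computable* if some algorithm finds, for every $n$, an integer $a_n$ with $|x-a_n2^{-n}|\le2^{-n}$. **Proposition.** The neural complexity $\mathcal N$ is upper-semicomputable but not computable. More precisely, for all real $0<\delta\le M$: (i) if the resolution $\delta$ is a computable real number (for example, rational), then $\mathcal N$ is upper-semicomputable; (ii) $\mathcal N$ is not computable. -/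

import Mathlib

/-- An affine layer `ℝ^m → ℝ^n`, `x ↦ W x + b`; its parameters are the entries of `W` and `b`. -/
structure AffineLayer (m n : ℕ) where
  weight : Matrix (Fin n) (Fin m) ℝ
  bias : Fin n → ℝ

namespace AffineLayer

noncomputable def eval {m n : ℕ} (A : AffineLayer m n) (x : Fin m → ℝ) : Fin n → ℝ :=
  A.weight.mulVec x + A.bias

/-- The number of non-zero parameters of the layer. -/
noncomputable def numNonzero {m n : ℕ} (A : AffineLayer m n) : ℕ :=
  (Finset.univ.filter fun ij : Fin n × Fin m => A.weight ij.1 ij.2 ≠ 0).card +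
    (Finset.univ.filter fun i : Fin n => A.bias i ≠ 0).card

end AffineLayer

/-- The set `δ·ℤ ∩ [-M, M]` of representable parameter values. -/
def fixedPrecisionValues (δ M : ℝ) : Set ℝ :=
  {w | (∃ k : ℤ, w = δ * k) ∧ w ∈ Set.Icc (-M) M}

/-- All parameters of the layer lie in `δ·ℤ ∩ [-M, M]`. -/
def AffineLayer.IsFixedPrecision {m n : ℕ} (δ M : ℝ) (A : AffineLayer m n) : Prop :=
  (∀ i j, A.weight i j ∈ fixedPrecisionValues δ M) ∧ ∀ i, A.bias i ∈ fixedPrecisionValues δ M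

/-- Feedforward networks `ℝ^m → ℝ^n` with any number `L ≥ 1` of affine layers, any hidden widths,
and the ReLU activation between consecutive layers (and not after the last one). -/
inductive FeedforwardNet : ℕ → ℕ → Type
  | last {m n : ℕ} (A : AffineLayer m n) : FeedforwardNet m n
  | cons {m k n : ℕ} (A : AffineLayer m k) (f : FeedforwardNet k n) : FeedforwardNet m n

namespace FeedforwardNet

/-- The function computed by the network: `A_L ∘ ReLU ∘ A_{L-1} ∘ ⋯ ∘ ReLU ∘ A_1`. -/
noncomputable def eval : {m n : ℕ} → FeedforwardNet m n → (Fin m → ℝ) → (Fin n → ℝ)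
  | _, _, last A, x => A.eval x
  | _, _, cons A f, x => f.eval fun i => max (A.eval x i) 0

/-- The non-zero parameter count `‖θ‖₀` of the network. -/
noncomputable def numNonzero : {m n : ℕ} → FeedforwardNet m n → ℕ
  | _, _, last A => A.numNonzero
  | _, _, cons A f => A.numNonzero + f.numNonzero

/-- `θ ∈ Θ_{δ,M}`: every parameter of the network lies in `δ·ℤ ∩ [-M, M]`. -/
def IsFixedPrecision (δ M : ℝ) : {m n : ℕ} → FeedforwardNet m n → Prop
  | _, _, last A => A.IsFixedPrecision δ M
  | _, _, cons A f => A.IsFixedPrecision δ M ∧ f.IsFixedPrecision δ M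

end FeedforwardNet

/-- A looped neural network: a feedforward block on the state space `ℝ^n`. The state has (at least)
the three designated coordinates `halt`, `emit` and `bit`. -/
structure LoopedNet where
  n : ℕ
  three_le : 3 ≤ n
  block : FeedforwardNet n n

namespace LoopedNet

/-- The state `x_t`: `x_0 = 0` and `x_{t+1} = f_θ(x_t)`. -/
noncomputable def state (N : LoopedNet) (t : ℕ) : Fin N.n → ℝ :=
  N.block.eval^[t] 0

/-- The value of the halt channel (coordinate 1) at iteration `t`. -/
noncomputable def halt (N : LoopedNet) (t : ℕ) : ℝ := N.state t ⟨0, by have := N.three_le; omega⟩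

/-- The value of the emit channel (coordinate 2) at iteration `t`. -/
noncomputable def emit (N : LoopedNet) (t : ℕ) : ℝ := N.state t ⟨1, by have := N.three_le; omega⟩

/-- The value of the bit channel (coordinate 3) at iteration `t`. -/
noncomputable def bit (N : LoopedNet) (t : ℕ) : ℝ := N.state t ⟨2, by have := N.three_le; omega⟩

/-- The bits appended to the output during the iterations `1, …, t`, if the network does not halt
at any of them. -/
noncomputable def emitted (N : LoopedNet) : ℕ → List Bool
  | 0 => []
  | t + 1 => if 0 < N.emit (t + 1) then N.emitted t ++ [decide (0 < N.bit (t + 1))] else N.emitted t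

/-- The network outputs `s`: its first halting iteration is `τ + 1`, and the bits accumulated
during the iterations `1, …, τ` form the string `s`. -/
def Outputs (N : LoopedNet) (s : List Bool) : Prop :=
  ∃ τ : ℕ, 0 < N.halt (τ + 1) ∧ (∀ t, 1 ≤ t → t ≤ τ → ¬ 0 < N.halt t) ∧ N.emitted τ = s

end LoopedNet

/-- The neural complexity `𝒩(s)` in precision `(δ, M)`: the infimum (in `ℕ ∪ {∞}`, so `∞` over the
empty set) of `‖θ‖₀` over the looped networks `θ ∈ Θ_{δ,M}` that output `s`. -/
noncomputable def neuralComplexity (δ M : ℝ) (s : List Bool) : ℕ∞ :=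
  sInf {c | ∃ N : LoopedNet, N.block.IsFixedPrecision δ M ∧ N.Outputs s ∧
    c = (N.block.numNonzero : ℕ∞)}

/-- The element of `ℕ ∪ {∞}` named by an `Option ℕ`, with `none` standing for `∞`. -/
def extNat : Option ℕ → ℕ∞
  | none => ⊤
  | some n => (n : ℕ∞)

/-- `F : {0,1}* → ℕ ∪ {∞}` is computable. -/
def IsComputableENat (F : List Bool → ℕ∞) : Prop :=
  ∃ φ : List Bool → Option ℕ, Computable φ ∧ ∀ s, extNat (φ s) = F s

/-- `F : {0,1}* → ℕ ∪ {∞}` is upper-semicomputable: it is the pointwise limit of a computable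
sequence of approximations from above, `φ(s,0) ≥ φ(s,1) ≥ ⋯ → F(s)`. -/
def IsUpperSemicomputable (F : List Bool → ℕ∞) : Prop :=
  ∃ φ : List Bool → ℕ → Option ℕ, Computable₂ φ ∧
    ∀ s, Antitone (fun k => extNat (φ s k)) ∧
      Filter.Tendsto (fun k => extNat (φ s k)) Filter.atTop (nhds (F s))

/-- `x` is a computable real number: some algorithm finds, for every `n`, a dyadic rational
`a / 2^n` within distance `2^{-n}` of `x`. -/
def IsComputableReal (x : ℝ) : Prop :=
  ∃ a : ℕ → ℤ, Computable a ∧ ∀ n : ℕ, |x - (a n : ℝ) / 2 ^ n| ≤ 1 / 2 ^ n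

/-!
Let `K = ⌊M / δ⌋`. A network with at most `m` non-zero parameters has at most `m` active channels in
each layer, so it can be relabelled to the constant width `m + 3`; if it outputs a non-empty string,
its depth is less than `m`. As every parameter is one of `2 K + 1` multiples of `δ`, only finitely
many strings have complexity at most `m`, and `𝒩` is unbounded.

For every computable `S : ℕ → {0,1}*`, a counter program with `p + O(1)` instructions outputs `S p`,
and a looped network with one hidden layer and the weights `0, ± δ` simulates it with `O(p²)`
parameters. An iteration multiplies the encoded configuration by `k δ²`, where `k` is the number of
copies of each hidden neuron; for `k δ² ≥ 1` the scale stays at least `1`, which lets one neuron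
recognize the initial state `0`. If `𝒩` were computable, then so would be an `S` with
`𝒩 (S p) > (p + 1)³`, a contradiction: this is Berry's paradox.

The states of a network are values at `δ` of integer polynomials, and the activation only asks for
their signs. If `δ` is computable, positivity of such a value is decidable: the cases `> 0` and
`< 0` are found by approximation, the case `= 0` by exhibiting a non-zero integer multiple of the
polynomial that is divisible by a fixed one. So one can search through all networks of constant
width and count the parameters of those that have halted with the right output.
-/

/-! ### Programs for counter machines -/

/-- Structured programs over counters indexed by `ℕ`. The body of `loop r p` is executed after
decrementing `r`, as long as `r` is not zero. -/
inductive CounterProg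
  | skip
  | inc (r : ℕ)
  | emit (b : Bool)
  | seq (p q : CounterProg)
  | loop (r : ℕ) (p : CounterProg)

namespace CounterProg

open Function (update)

/-- `Run p σ o σ'`: started in the counter values `σ`, the program `p` terminates in the counter
values `σ'` and outputs the bits `o`. -/
inductive Run : CounterProg → (ℕ → ℕ) → List Bool → (ℕ → ℕ) → Prop
  | skip (σ) : Run skip σ [] σ
  | inc (r σ) : Run (inc r) σ [] (update σ r (σ r + 1))
  | emit (b σ) : Run (emit b) σ [b] σ
  | seq {p q σ σ₁ σ₂ o₁ o₂} : Run p σ o₁ σ₁ → Run q σ₁ o₂ σ₂ → Run (seq p q) σ (o₁ ++ o₂) σ₂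
  | loop_done {r p σ} : σ r = 0 → Run (loop r p) σ [] σ
  | loop_step {r p σ σ₁ σ₂ o₁ o₂ n} : σ r = n + 1 → Run p (update σ r n) o₁ σ₁ →
      Run (loop r p) σ₁ o₂ σ₂ → Run (loop r p) σ (o₁ ++ o₂) σ₂

theorem Run.congr {p σ o σ₁ σ₂} (h : Run p σ o σ₁) (e : σ₁ = σ₂) : Run p σ o σ₂ := e ▸ h

theorem Run.silent_seq {p q σ σ₁ σ₂} (h₁ : Run p σ [] σ₁) (h₂ : Run q σ₁ [] σ₂) :
    Run (.seq p q) σ [] σ₂ := h₁.seq h₂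

theorem Run.countdown {r p} (st : ℕ → ℕ → ℕ) (hr : ∀ k, st k r = k) :
    ∀ n, (∀ k < n, Run p (update (st (k + 1)) r k) [] (st k)) →
      Run (loop r p) (st n) [] (st 0)
  | 0, _ => .loop_done (hr 0)
  | n + 1, h => .loop_step (o₁ := []) (o₂ := []) (hr _) (h n n.lt_succ_self)
      (countdown st hr n fun k hk => h k (hk.trans n.lt_succ_self))

/-- Set a counter to `0`. -/
def clear (r : ℕ) : CounterProg := loop r skip

theorem run_clear (r σ) : Run (clear r) σ [] (update σ r 0) := by
  have := Run.countdown (r := r) (p := skip) (fun k => update σ r k) (by simp) (σ r) fun k _ =>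
    (Run.skip _).congr (by simp)
  simpa [clear] using this

/-- Add the first counter to the second one and set the first one to `0`. -/
def move (a b : ℕ) : CounterProg := loop a (inc b)

theorem run_move {a b} (σ) (hab : a ≠ b) :
    Run (move a b) σ [] (update (update σ a 0) b (σ b + σ a)) := by
  have := Run.countdown (r := a) (p := inc b)
    (fun k => update (update σ a k) b (σ b + (σ a - k))) (by grind [Function.update_apply]) (σ a)
    fun k hk => (Run.inc b _).congr (by ext x; grind [Function.update_apply])
  simpa [move] using this

/-- Copy a counter to one that holds `0`, with the help of another one that holds `0`. -/
def copy (a b c : ℕ) : CounterProg := seq (loop a (seq (inc b) (inc c))) (move c a)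

theorem run_copy {a b c} (σ) (hab : a ≠ b) (hac : a ≠ c) (hbc : b ≠ c) (hb : σ b = 0)
    (hc : σ c = 0) : Run (copy a b c) σ [] (update σ b (σ a)) := by
  have split := Run.countdown (r := a) (p := seq (inc b) (inc c))
    (fun k => update (update (update σ a k) b (σ a - k)) c (σ a - k)) (by simp [hab, hac]) (σ a)
    fun k hk => ((Run.inc b _).silent_seq (.inc c _)).congr
      (by ext x; grind [Function.update_apply])
  have start : update (update (update σ a (σ a)) b (σ a - σ a)) c (σ a - σ a) = σ := by
    ext x; grind [Function.update_apply]
  beta_reduce at split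
  rw [start] at split
  exact (split.silent_seq (run_move _ hac.symm)).congr (by ext x; grind [Function.update_apply])

/-- Set the counters `b, …, b + n - 1` to `0`. -/
def clearRange (b : ℕ) : ℕ → CounterProg
  | 0 => skip
  | n + 1 => seq (clearRange b n) (clear (b + n))

theorem run_clearRange (b : ℕ) : ∀ n σ,
    Run (clearRange b n) σ [] fun r => if b ≤ r ∧ r < b + n then 0 else σ r
  | 0, σ => (Run.skip σ).congr (by ext x; grind)
  | n + 1, σ => ((run_clearRange b n σ).silent_seq (run_clear _ _)).congr
      (by ext x; grind [Function.update_apply])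

/-- `f` can be computed by programs that read the arguments from any given counters below `b`,
write the value to the counter `b`, and use the counters above `b` as scratch space. -/
def Computes {n : ℕ} (f : List.Vector ℕ n →. ℕ) : Prop :=
  ∀ (ins : Fin n → ℕ) (b : ℕ), (∀ i, ins i < b) → ∃ P : CounterProg,
    ∀ σ : ℕ → ℕ, (∀ r ≥ b, σ r = 0) →
      ∀ y ∈ f (List.Vector.ofFn fun i => σ (ins i)), Run P σ [] (update σ b y)

theorem computes_zero : Computes (n := 0) fun _ => Part.some 0 := by
  refine fun ins b _ => ⟨skip, fun σ hσ y hy => (Run.skip σ).congr ?_⟩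
  obtain rfl : y = 0 := by simpa using hy
  rw [← hσ b le_rfl, Function.update_eq_self]

theorem computes_get {n} (i : Fin n) :
    Computes fun v : List.Vector ℕ n => Part.some (v.get i) := by
  intro ins b hb
  refine ⟨copy (ins i) b (b + 1), fun σ hσ y hy => ?_⟩
  have := hb i
  obtain rfl : y = σ (ins i) := by simpa using hy
  exact run_copy σ (by omega) (by omega) (by omega) (hσ _ le_rfl) (hσ _ (by omega))

theorem computes_succ : Computes fun v : List.Vector ℕ 1 => Part.some v.head.succ := by
  intro ins b hb
  obtain ⟨P, hP⟩ := computes_get (0 : Fin 1) ins b hb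
  refine ⟨seq P (inc b), fun σ hσ y hy => ?_⟩
  obtain rfl : y = σ (ins 0) + 1 := by simpa using hy
  exact ((hP σ hσ (σ (ins 0)) (by simp)).silent_seq (.inc _ _)).congr (by simp)

theorem get_mem_of_mem_mOfFn {α : Type*} : ∀ {n : ℕ} {g : Fin n → Part α} {v : List.Vector α n},
    v ∈ List.Vector.mOfFn g → ∀ i, v.get i ∈ g i
  | 0, _, _, _, i => i.elim0
  | n + 1, g, v, hv, i => by
    simp only [List.Vector.mOfFn, Part.bind_eq_bind, Part.pure_eq_some, Part.mem_bind_iff,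
      Part.mem_some_iff] at hv
    obtain ⟨a, ha, w, hw, rfl⟩ := hv
    refine Fin.cases (by simpa using ha) (fun i => ?_) i
    simpa using get_mem_of_mem_mOfFn hw i

theorem exists_run_forall_of_computes {m n : ℕ} {g : Fin n → List.Vector ℕ m →. ℕ}
    (hg : ∀ i, Computes (g i)) (ins : Fin m → ℕ) (b : ℕ) (hb : ∀ i, ins i < b) :
    ∀ k ≤ n, ∃ P, ∀ σ : ℕ → ℕ, (∀ r ≥ b, σ r = 0) → ∀ ys : ℕ → ℕ,
      (∀ i : Fin n, ys i ∈ g i (List.Vector.ofFn fun i => σ (ins i))) →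
      Run P σ [] fun r => if b ≤ r ∧ r < b + k then ys (r - b) else σ r
  | 0, _ => ⟨skip, fun σ _ _ _ => (Run.skip σ).congr (by ext x; grind)⟩
  | k + 1, hk => by
    obtain ⟨P, hP⟩ := exists_run_forall_of_computes hg ins b hb k (by omega)
    obtain ⟨Q, hQ⟩ := hg ⟨k, by omega⟩ ins (b + k) fun i => (hb i).trans_le (by omega)
    refine ⟨seq P Q, fun σ hσ ys hys =>
      ((hP σ hσ ys hys).silent_seq (hQ _ ?_ (ys k) ?_)).congr ?_⟩
    · grind
    · convert hys ⟨k, by omega⟩ using 4 with i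
      grind
    · ext x; grind [Function.update_apply]

theorem Computes.comp {m n : ℕ} {f : List.Vector ℕ n →. ℕ} {g : Fin n → List.Vector ℕ m →. ℕ}
    (hf : Computes f) (hg : ∀ i, Computes (g i)) :
    Computes fun v => (List.Vector.mOfFn fun i => g i v) >>= f := by
  intro ins b hb
  obtain ⟨P, hP⟩ := exists_run_forall_of_computes hg ins (b + 1)
    (fun i => (hb i).trans b.lt_succ_self) n le_rfl
  obtain ⟨Q, hQ⟩ := hf (fun i => b + 1 + i) (b + 1 + n) (by simp)
  refine ⟨seq P (seq Q (seq (clearRange (b + 1) n) (move (b + 1 + n) b))), fun σ hσ y hy => ?_⟩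
  obtain ⟨v, hv, hy⟩ := Part.mem_bind_iff.1 hy
  have args := hP σ (by grind) (fun j => if h : j < n then v.get ⟨j, h⟩ else 0) fun i => by
    simpa using get_mem_of_mem_mOfFn hv i
  have value := hQ (fun r => if b + 1 ≤ r ∧ r < b + 1 + n then
    (if h : r - (b + 1) < n then v.get ⟨r - (b + 1), h⟩ else 0) else σ r) (by grind) y
    (by convert hy; ext i; simp)
  refine (args.silent_seq (value.silent_seq ((run_clearRange _ _ _).silent_seq
    (run_move _ (by omega))))).congr ?_
  ext x; grind [Function.update_apply]

/-- The main loop of a primitive recursion: the program `Q` computes the next value into the counter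
`b + 3`, the counter `b` holds the last value, `b + 1` its index, and `b + 2` the number of
remaining steps. -/
def precLoop (b : ℕ) (Q : CounterProg) : CounterProg :=
  loop (b + 2) (seq Q (seq (clear b) (seq (move (b + 3) b) (inc (b + 1)))))

/-- The counter values in `precLoop` when `F k` is the last value and `l` steps remain. -/
def precState (b : ℕ) (σ F : ℕ → ℕ) (k l : ℕ) : ℕ → ℕ :=
  update (update (update σ b (F k)) (b + 1) k) (b + 2) l

theorem run_precLoop {Q : CounterProg} {b : ℕ} {σ F : ℕ → ℕ} (h : σ (b + 3) = 0)
    (hQ : ∀ k l, Run Q (precState b σ F k l) []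
      (update (precState b σ F k l) (b + 3) (F (k + 1)))) (k : ℕ) :
    ∀ l, Run (precLoop b Q) (precState b σ F k l) [] (precState b σ F (k + l) 0)
  | 0 => .loop_done (by simp [precState])
  | l + 1 => by
    have body : Run (seq Q (seq (clear b) (seq (move (b + 3) b) (inc (b + 1)))))
        (precState b σ F k l) [] (precState b σ F (k + 1) l) := by
      refine ((hQ k l).silent_seq ((run_clear _ _).silent_seq
        ((run_move _ (by omega)).silent_seq (.inc _ _)))).congr ?_
      ext x
      simp only [precState]
      grind [Function.update_apply]
    have start : update (precState b σ F k (l + 1)) (b + 2) l = precState b σ F k l :=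
      Function.update_idem ..
    rw [show k + (l + 1) = k + 1 + l by omega]
    exact .loop_step (o₁ := []) (o₂ := []) (n := l) (by simp [precState]) (start ▸ body)
      (run_precLoop h hQ (k + 1) l)

theorem Computes.prec {n : ℕ} {f : List.Vector ℕ n → ℕ} {g : List.Vector ℕ (n + 2) → ℕ}
    (hf : Computes fun v => Part.some (f v)) (hg : Computes fun v => Part.some (g v)) :
    Computes fun v : List.Vector ℕ (n + 1) =>
      Part.some (v.head.rec (f v.tail) fun y IH => g (y ::ᵥ IH ::ᵥ v.tail)) := by
  intro ins b hb
  have hb0 := hb 0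
  obtain ⟨P, hP⟩ := hf (fun i => ins i.succ) b fun i => hb _
  obtain ⟨Q, hQ⟩ := hg (Fin.cons (b + 1) (Fin.cons b fun i => ins i.succ)) (b + 3) fun i => by
    refine Fin.cases (by simp) (fun i => Fin.cases (by simp) (fun i => ?_) i) i
    simpa using (hb i.succ).trans (by omega)
  refine ⟨seq P (seq (copy (ins 0) (b + 2) (b + 3)) (seq (precLoop b Q) (clear (b + 1)))),
    fun σ hσ y hy => ?_⟩
  set v := List.Vector.ofFn fun i : Fin n => σ (ins i.succ) with hv
  set F : ℕ → ℕ := fun k => Nat.rec (f v) (fun y IH => g (y ::ᵥ IH ::ᵥ v)) k with hF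
  set N := σ (ins 0)
  obtain rfl : y = F N := by simpa [List.Vector.ofFn, hF, hv] using hy
  have step (k l : ℕ) : Run Q (precState b σ F k l) []
      (update (precState b σ F k l) (b + 3) (F (k + 1))) := by
    refine hQ _ (by simp only [precState]; grind [Function.update_apply]) _ ?_
    simp only [List.Vector.ofFn, Fin.cons_zero, Fin.cons_succ, Part.mem_some_iff, hF]
    congr 2
    · simp [precState]
    · congr 1
      · simp [precState]
      · ext i
        have := hb i.succ
        simp only [hv, List.Vector.get_ofFn]
        simp only [precState]
        grind [Function.update_apply]
  refine (hP σ hσ (f v) (by simp [hv])).silent_seq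
    (((run_copy _ (by omega) (by omega) (by omega) ?_ ?_).congr ?_).silent_seq
      ((run_precLoop (hσ _ (by omega)) step 0 N).silent_seq ((run_clear _ _).congr ?_)))
  · simpa using hσ (b + 2) (by omega)
  · simpa using hσ (b + 3) (by omega)
  · rw [Function.update_of_ne (by omega), show f v = F 0 from rfl]
    ext x; simp only [precState]; grind [Function.update_apply]
  · ext x; simp only [precState]; grind [Function.update_apply]

theorem run_loop_search {P : CounterProg} {σ : ℕ → ℕ} {b y : ℕ} {v : ℕ → ℕ} (h1 : σ (b + 1) = 0)
    (hP : ∀ j, Run P (update σ b j) [] (update (update σ b j) (b + 1) (v j)))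
    (hy : v y = 0) (hlt : ∀ j < y, v j ≠ 0) : ∀ k j, j + k = y →
      Run (loop (b + 1) (seq (clear (b + 1)) (seq (inc b) P)))
        (update (update σ b j) (b + 1) (v j)) [] (update σ b y)
  | 0, j, hj => by
    obtain rfl : j = y := hj
    exact (Run.loop_done (by simpa using hy)).congr (by ext x; grind [Function.update_apply])
  | k + 1, j, hj => by
    obtain ⟨w, hw⟩ := Nat.exists_eq_succ_of_ne_zero (hlt j (by omega))
    refine .loop_step (o₁ := []) (o₂ := []) (n := w) (by simpa using hw)
      ((run_clear _ _).silent_seq (((Run.inc _ _).congr ?_).silent_seq (hP (j + 1))))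
      (run_loop_search h1 hP hy hlt k (j + 1) (by omega))
    ext x; grind [Function.update_apply]

theorem Computes.rfind {n : ℕ} {f : List.Vector ℕ (n + 1) → ℕ}
    (hf : Computes fun v => Part.some (f v)) :
    Computes fun v => Nat.rfind fun n => Part.some (decide (f (n ::ᵥ v) = 0)) := by
  intro ins b hb
  obtain ⟨P, hP⟩ := hf (Fin.cons b ins) (b + 1) fun i =>
    Fin.cases (by simp) (fun i => (hb i).trans (by simp)) i
  refine ⟨seq P (loop (b + 1) (seq (clear (b + 1)) (seq (inc b) P))), fun σ hσ y hy => ?_⟩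
  set v := List.Vector.ofFn fun i : Fin n => σ (ins i) with hv
  have evaluate (j : ℕ) :
      Run P (update σ b j) [] (update (update σ b j) (b + 1) (f (j ::ᵥ v))) := by
    refine hP _ (by grind [Function.update_apply]) _ ?_
    simp only [List.Vector.ofFn, Fin.cons_zero, Fin.cons_succ, Part.mem_some_iff,
      Function.update_self]
    congr 2
    ext i
    have := hb i
    simp only [hv, List.Vector.get_ofFn]
    grind [Function.update_apply]
  have start : update σ b 0 = σ := by rw [← hσ b le_rfl, Function.update_eq_self]
  obtain ⟨hzero, hlt⟩ := Nat.mem_rfind.1 hy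
  have search := run_loop_search (hσ (b + 1) (by omega)) evaluate (by simpa using hzero)
    (fun j hj => by simpa using hlt hj) y 0 (by omega)
  have first := evaluate 0
  rw [start] at first search
  exact first.silent_seq search

theorem computes_of_primrec' {n : ℕ} {f : List.Vector ℕ n → ℕ} (hf : Nat.Primrec' f) :
    Computes fun v => Part.some (f v) := by
  induction hf with
  | zero => exact computes_zero
  | succ => exact computes_succ
  | get i => exact computes_get i
  | comp g _ _ hf hg => simpa using hf.comp hg
  | prec _ _ hf hg => exact hf.prec hg

theorem computes_of_partrec' {n : ℕ} {f : List.Vector ℕ n →. ℕ} (hf : Nat.Partrec' f) :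
    Computes f := by
  induction hf with
  | prim hf => exact computes_of_primrec' hf
  | comp g _ _ hf hg => exact hf.comp hg
  | rfind _ hf => exact hf.rfind

/-- The content of the counter `2` that makes `emitBit` output a given bit. As `0` makes the main
loop of `exists_run_of_computable` stop, it stands for the end of the output. -/
def bitCode : Option Bool → ℕ
  | none => 0
  | some b => b.toNat + 1

/-- Output the bit `b` if the counter `2` holds `b.toNat`. -/
def emitBit : CounterProg :=
  seq (inc 3) (seq (loop 2 (seq (clear 3) (emit true))) (loop 3 (emit false)))

theorem run_emitBit (σ : ℕ → ℕ) (b : Bool) (h2 : σ 2 = 0) (h3 : σ 3 = 0) :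
    Run emitBit (update σ 2 b.toNat) [b] σ := by
  have flag : Run (inc 3) (update σ 2 b.toNat) [] (update (update σ 2 b.toNat) 3 1) :=
    (Run.inc _ _).congr (by simp [h3])
  cases b with
  | false =>
    have out : Run (loop 3 (emit false)) (update (update σ 2 0) 3 1) [false] σ :=
      .loop_step (n := 0) (o₁ := [false]) (by simp)
        ((Run.emit _ _).congr (by ext x; grind [Function.update_apply])) (.loop_done h3)
    exact flag.seq ((Run.loop_done (by simp)).seq (o₁ := []) out)
  | true =>
    have out : Run (loop 2 (seq (clear 3) (emit true))) (update (update σ 2 1) 3 1) [true] σ :=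
      .loop_step (n := 0) (o₁ := [true]) (by simp)
        ((run_clear _ _).seq ((Run.emit _ _).congr (by ext x; grind [Function.update_apply])))
        (.loop_done h2)
    exact flag.seq (out.seq (o₂ := []) (.loop_done h3))

theorem exists_run_loop_emitBit {G : CounterProg} {σ : ℕ → ℕ} {L : List Bool} (h2 : σ 2 = 0)
    (h3 : σ 3 = 0)
    (hG : ∀ i, Run G (update σ 1 i) [] (update (update σ 1 i) 2 (bitCode L[i]?))) :
    ∀ l i, L.drop i = l → ∃ τ, Run (loop 2 (seq emitBit (seq (inc 1) G)))
      (update (update σ 1 i) 2 (bitCode L[i]?)) l τ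
  | [], i, hl => ⟨_, .loop_done (by
      rw [Function.update_self, List.getElem?_eq_none (List.drop_eq_nil_iff.1 hl), bitCode])⟩
  | b :: l, i, hl => by
    obtain ⟨τ, hτ⟩ := exists_run_loop_emitBit h2 h3 hG l (i + 1)
      (by rw [← List.tail_drop, hl, List.tail_cons])
    have hb : L[i]? = some b := by rw [← List.head?_drop, hl, List.head?_cons]
    rw [hb]
    refine ⟨τ, Run.loop_step (o₁ := [b]) (n := b.toNat) (by simp [bitCode]) ?_ hτ⟩
    rw [Function.update_idem]
    refine (run_emitBit _ _ (by simpa) (by simpa)).seq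
      (((Run.inc _ _).congr ?_).silent_seq (hG (i + 1)))
    simp

theorem exists_run_of_computable {S : ℕ → List Bool} (hS : Computable S) :
    ∃ P : CounterProg, ∀ p : ℕ, ∃ σ, Run P (update 0 0 p) (S p) σ := by
  have hbit : Computable bitCode :=
    (Primrec.option_casesOn .id (.const 0)
      (Primrec.succ.comp ((Primrec.dom_finite Bool.toNat).comp .snd)).to₂).to_comp.of_eq
      fun o => by cases o <;> rfl
  obtain ⟨G, hG⟩ := computes_of_partrec' (f := fun v : List.Vector ℕ 2 =>
    Part.some (bitCode (S v.head)[v.tail.head]?))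
    (Nat.Partrec'.of_part <| hbit.comp <| Computable.list_getElem?.comp
      (hS.comp .vector_head) (Computable.vector_head.comp .vector_tail)) (fun i => i) 2 (·.2)
  refine ⟨seq G (loop 2 (seq emitBit (seq (inc 1) G))), fun p => ?_⟩
  have query (i : ℕ) : Run G (update (update 0 0 p) 1 i) []
      (update (update (update 0 0 p) 1 i) 2 (bitCode (S p)[i]?)) :=
    hG _ (fun r hr => by simp only [Function.update_apply, Pi.zero_apply]; grind) _
      (by simp [List.Vector.ofFn])
  obtain ⟨τ, hτ⟩ := exists_run_loop_emitBit (by simp) (by simp) query (S p) 0 rfl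
  have start : update (update (0 : ℕ → ℕ) 0 p) 1 0 = update (0 : ℕ → ℕ) 0 p :=
    Function.update_eq_self_iff.2 (by simp)
  have first := query 0
  rw [start] at first hτ
  exact ⟨τ, first.seq hτ⟩

end CounterProg

/-- An instruction of a counter machine: jump to `onZero` if `decr` is a counter that holds `0` and
to `next` otherwise, decrement the counter `decr` and increment the counter `incr`, and output the
bit `out`; each of `decr`, `incr` and `out` may be absent. -/
structure CounterInstr where
  decr : Option ℕ
  incr : Option ℕ
  out : Option Bool
  next : ℕ
  onZero : ℕ

namespace CounterInstr

/-- The address and the counter values after the execution of an instruction. -/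
def exec (i : CounterInstr) (σ : ℕ → ℕ) : ℕ × (ℕ → ℕ) :=
  (if i.decr.map σ = some 0 then i.onZero else i.next,
    fun r => (σ r - if i.decr = some r then 1 else 0) + if i.incr = some r then 1 else 0)

/-- All counters of the instruction are below `m`. -/
def CountersLT (m : ℕ) (i : CounterInstr) : Prop :=
  (∀ r, i.decr = some r → r < m) ∧ ∀ r, i.incr = some r → r < m

/-- `Steps C c o c'`: the list `C` of instructions leads from the configuration `c` (an address and
counter values) to `c'` and outputs the bits `o`. -/
inductive Steps (C : List CounterInstr) : ℕ × (ℕ → ℕ) → List Bool → ℕ × (ℕ → ℕ) → Prop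
  | refl (c) : Steps C c [] c
  | step {c o q σ i} : Steps C c o (q, σ) → C[q]? = some i →
      Steps C c (o ++ i.out.toList) (i.exec σ)

theorem Steps.trans {C c o c' o' c''} (h : Steps C c o c') (h' : Steps C c' o' c'') :
    Steps C c (o ++ o') c'' := by
  induction h' with
  | refl => rwa [List.append_nil]
  | step _ hi ih => exact List.append_assoc _ _ _ ▸ ih.step hi

theorem Steps.single {C q i σ c'} (h : C[q]? = some i) (e : i.exec σ = c') :
    Steps C (q, σ) i.out.toList c' :=
  e ▸ (Steps.refl (q, σ)).step h

/-- `C` contains the list `D` of instructions at the address `a`. -/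
def HasCode (C D : List CounterInstr) (a : ℕ) : Prop := ∀ i < D.length, C[a + i]? = D[i]?

theorem HasCode.left {C D E a} (h : HasCode C (D ++ E) a) : HasCode C D a := fun i hi => by
  rw [h i (by simp; omega), List.getElem?_append_left hi]

theorem HasCode.right {C D E a} (h : HasCode C (D ++ E) a) : HasCode C E (a + D.length) :=
  fun i hi => by
    rw [add_assoc, h (D.length + i) (by simp; omega), List.getElem?_append_right (by omega),
      Nat.add_sub_cancel_left]

theorem HasCode.head {C i D a} (h : HasCode C (i :: D) a) : C[a]? = some i := by
  simpa using h 0 (by simp)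

theorem HasCode.tail {C i D a} (h : HasCode C (i :: D) a) : HasCode C D (a + 1) :=
  HasCode.right (D := [i]) h

end CounterInstr

namespace CounterProg

open CounterInstr

/-- The number of instructions of the compiled program. -/
def size : CounterProg → ℕ
  | skip => 1
  | inc _ => 1
  | emit _ => 1
  | seq p q => p.size + q.size
  | loop _ p => p.size + 1

/-- The instructions of a program that starts at the address `a` and leaves to the address `b`. -/
def compile : CounterProg → ℕ → ℕ → List CounterInstr
  | skip, _, b => [⟨none, none, none, b, b⟩]
  | inc r, _, b => [⟨none, some r, none, b, b⟩]
  | emit x, _, b => [⟨none, none, some x, b, b⟩]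
  | seq p q, a, b => p.compile a (a + p.size) ++ q.compile (a + p.size) b
  | loop r p, a, b => ⟨some r, none, none, a + 1, b⟩ :: p.compile (a + 1) a

theorem length_compile : ∀ (p : CounterProg) (a b : ℕ), (p.compile a b).length = p.size
  | skip, _, _ => rfl
  | inc _, _, _ => rfl
  | emit _, _, _ => rfl
  | seq p q, a, b => by simp [compile, size, length_compile p, length_compile q]
  | loop r p, a, b => by simp [compile, size, length_compile p]

theorem Run.steps {C p σ o σ'} (h : Run p σ o σ') :
    ∀ a b, HasCode C (p.compile a b) a → Steps C (a, σ) o (b, σ') := by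
  induction h with
  | skip σ => exact fun a b h => .single h.head (by simp [exec])
  | inc r σ =>
    exact fun a b h => .single h.head
      (Prod.ext rfl (funext fun x => by simp only [exec]; grind [Function.update_apply]))
  | emit x σ => exact fun a b h => .single h.head (by simp [exec])
  | seq _ _ ih₁ ih₂ =>
    intro a b h
    have right := h.right
    rw [length_compile] at right
    exact (ih₁ a _ h.left).trans (ih₂ _ b right)
  | loop_done h0 =>
    exact fun a b h => .single h.head
      (Prod.ext (by simp [exec, h0]) (funext fun x => by simp only [exec]; grind))
  | @loop_step r p σ σ₁ σ₂ o₁ o₂ n hn _ _ ih₁ ih₂ =>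
    intro a b h
    have enter : Steps C (a, σ) [] (a + 1, Function.update σ r n) := .single h.head
      (Prod.ext (by simp [exec, hn]) (funext fun x => by
        simp only [exec]; grind [Function.update_apply]))
    exact (enter.trans (ih₁ _ _ h.tail)).trans (ih₂ a b h)

/-- An upper bound on the counters of a program. -/
def counterBound : CounterProg → ℕ
  | skip => 0
  | inc r => r + 1
  | emit _ => 0
  | seq p q => max p.counterBound q.counterBound
  | loop r p => max (r + 1) p.counterBound

theorem countersLT_compile {m : ℕ} : ∀ {p : CounterProg}, p.counterBound ≤ m →
    ∀ a b, ∀ i ∈ p.compile a b, i.CountersLT m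
  | skip, _, _, _ => by simp [compile, CountersLT]
  | inc _, hp, _, _ => by simpa [compile, CountersLT, counterBound] using hp
  | emit _, _, _, _ => by simp [compile, CountersLT]
  | seq _ _, hp, _, _ => fun i hi => (List.mem_append.1 hi).elim
      (countersLT_compile (le_of_max_le_left hp) _ _ i)
      (countersLT_compile (le_of_max_le_right hp) _ _ i)
  | loop _ _, hp, _, _ => List.forall_mem_cons.2 ⟨⟨by simpa using le_of_max_le_left hp, by simp⟩,
      countersLT_compile (le_of_max_le_right hp) _ _⟩

/-- Increment the counter `0` a given number of times. -/
def incs : ℕ → CounterProg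
  | 0 => skip
  | n + 1 => seq (incs n) (inc 0)

theorem run_incs : ∀ n, Run (incs n) 0 [] (Function.update 0 0 n)
  | 0 => (Run.skip _).congr (by simp)
  | n + 1 => ((run_incs n).silent_seq (.inc _ _)).congr (by simp)

theorem size_incs : ∀ n, (incs n).size = n + 1
  | 0 => rfl
  | n + 1 => by rw [incs, size, size_incs n, size]

theorem counterBound_incs_le : ∀ n, (incs n).counterBound ≤ 1
  | 0 => Nat.zero_le _
  | n + 1 => max_le (counterBound_incs_le n) le_rfl

end CounterProg

theorem CounterInstr.exists_steps_of_computable {S : ℕ → List Bool} (hS : Computable S) :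
    ∃ m c : ℕ, ∀ p : ℕ, ∃ C : List CounterInstr, C.length = p + c ∧
      (∀ i ∈ C, i.CountersLT m) ∧ ∃ σ, Steps C (0, 0) (S p) (C.length, σ) := by
  obtain ⟨P, hP⟩ := CounterProg.exists_run_of_computable hS
  refine ⟨max 1 P.counterBound, P.size + 1, fun p =>
    ⟨((CounterProg.incs p).seq P).compile 0 (p + (P.size + 1)), ?_, ?_, ?_⟩⟩
  · rw [CounterProg.length_compile, CounterProg.size, CounterProg.size_incs]
    omega
  · exact CounterProg.countersLT_compile
      (max_le_max (CounterProg.counterBound_incs_le p) le_rfl) 0 _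
  · obtain ⟨σ, hσ⟩ := hP p
    refine ⟨σ, ?_⟩
    rw [CounterProg.length_compile, CounterProg.size, CounterProg.size_incs,
      show p + 1 + P.size = p + (P.size + 1) by omega]
    exact ((CounterProg.run_incs p).seq hσ).steps 0 _ fun i _ => by rw [zero_add]

/-! ### Simulation by looped networks -/

theorem mul_signType_mem_fixedPrecisionValues {δ M : ℝ} (hδ : 0 < δ) (hM : δ ≤ M) (s : SignType) :
    δ * (s : ℝ) ∈ fixedPrecisionValues δ M := by
  refine ⟨⟨s, by cases s <;> simp⟩, ?_⟩
  rcases s with _ | _ | _ <;> simp [hM, hδ.le, hδ.le.trans hM, neg_le_iff_add_nonneg, add_nonneg]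

theorem signType_coe_ite (p : Prop) [Decidable p] (a b : SignType) :
    ((if p then a else b : SignType) : ℝ) = if p then (a : ℝ) else b :=
  apply_ite _ p a b

theorem AffineLayer.numNonzero_le {m n : ℕ} (A : AffineLayer m n) : A.numNonzero ≤ n * m + n := by
  refine Nat.add_le_add ((Finset.card_filter_le _ _).trans_eq ?_)
    ((Finset.card_filter_le _ _).trans_eq ?_) <;> simp

/-- The weights of a looped network whose block has one hidden layer: up to the factor `δ`, they lie
in `{-1, 0, 1}`. The hidden neurons are indexed by `η`, and the state coordinates by `Fin 3 ⊕ κ`,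
where the output channels `Fin 3` are not read by the block. -/
structure TernaryBlock (κ η : Type*) where
  input : η → κ → SignType
  bias : η → SignType
  output : Fin 3 ⊕ κ → η → SignType

namespace TernaryBlock

variable {κ η : Type*} [Fintype κ] [Fintype η] (B : TernaryBlock κ η) (δ : ℝ) (k : ℕ)

/-- The value of a hidden neuron. -/
noncomputable def hidden (x : κ → ℝ) (h : η) : ℝ :=
  max (δ * (∑ i, B.input h i * x i + B.bias h)) 0

/-- The state of the looped network in which every hidden neuron has `k` copies. -/
noncomputable def state : ℕ → Fin 3 ⊕ κ → ℝ
  | 0, _ => 0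
  | t + 1, j => k * δ * ∑ h, B.output j h * B.hidden δ (fun i => state t (.inr i)) h

/-- The numbering of the state coordinates, which starts with the output channels. -/
noncomputable def coordEquiv (κ : Type*) [Fintype κ] : Fin 3 ⊕ κ ≃ Fin (3 + Fintype.card κ) :=
  (Equiv.sumCongr (Equiv.refl _) (Fintype.equivFin κ)).trans finSumFinEquiv

/-- The numbering of the copies of the hidden neurons. -/
noncomputable def copyEquiv (η : Type*) [Fintype η] (k : ℕ) :
    η × Fin k ≃ Fin (Fintype.card η * k) :=
  Fintype.equivFinOfCardEq (by simp)

/-- The first layer of the looped network. -/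
noncomputable def inputLayer : AffineLayer (3 + Fintype.card κ) (Fintype.card η * k) where
  weight h i := δ * (Sum.elim (fun _ => 0) (B.input ((copyEquiv η k).symm h).1)
    ((coordEquiv κ).symm i) : SignType)
  bias h := δ * B.bias ((copyEquiv η k).symm h).1

/-- The second layer of the looped network. -/
noncomputable def outputLayer : AffineLayer (Fintype.card η * k) (3 + Fintype.card κ) where
  weight j h := δ * B.output ((coordEquiv κ).symm j) ((copyEquiv η k).symm h).1
  bias _ := δ * (0 : SignType)

/-- The looped network with the given weights, in which every hidden neuron has `k` copies. -/
noncomputable def toLoopedNet : LoopedNet :=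
  ⟨3 + Fintype.card κ, by omega, .cons (B.inputLayer δ k) (.last (B.outputLayer δ k))⟩

theorem isFixedPrecision_toLoopedNet {M : ℝ} (hδ : 0 < δ) (hM : δ ≤ M) :
    (B.toLoopedNet δ k).block.IsFixedPrecision δ M :=
  have mem := mul_signType_mem_fixedPrecisionValues hδ hM
  ⟨⟨fun _ _ => mem _, fun _ => mem _⟩, fun _ _ => mem _, fun _ => mem _⟩

theorem numNonzero_toLoopedNet_le : (B.toLoopedNet δ k).block.numNonzero ≤
    2 * (Fintype.card η * k + 1) * (Fintype.card κ + 4) := by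
  have h1 := (B.inputLayer δ k).numNonzero_le
  have h2 := (B.outputLayer δ k).numNonzero_le
  change (B.inputLayer δ k).numNonzero + (B.outputLayer δ k).numNonzero ≤ _
  nlinarith

theorem eval_inputLayer (x : Fin (3 + Fintype.card κ) → ℝ) (h : η × Fin k) :
    max ((B.inputLayer δ k).eval x (copyEquiv η k h)) 0 =
      B.hidden δ (fun i => x (coordEquiv κ (.inr i))) h.1 := by
  simp only [AffineLayer.eval, Pi.add_apply, Matrix.mulVec, dotProduct, hidden]
  rw [← (coordEquiv κ).sum_comp, Fintype.sum_sum_type]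
  simp [inputLayer, mul_add, Finset.mul_sum, mul_assoc]

theorem state_toLoopedNet (t : ℕ) (j : Fin 3 ⊕ κ) :
    (B.toLoopedNet δ k).state t (coordEquiv κ j) = B.state δ k t j := by
  induction t generalizing j with
  | zero => rfl
  | succ t ih =>
    have step : (B.toLoopedNet δ k).state (t + 1) = (B.outputLayer δ k).eval fun h =>
        max ((B.inputLayer δ k).eval ((B.toLoopedNet δ k).state t) h) 0 :=
      Function.iterate_succ_apply' _ _ _
    have hidden_eq (h : η × Fin k) :
        max ((B.inputLayer δ k).eval ((B.toLoopedNet δ k).state t) (copyEquiv η k h)) 0 =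
          B.hidden δ (fun i => B.state δ k t (.inr i)) h.1 :=
      (B.eval_inputLayer δ k _ h).trans (by simp only [ih])
    rw [step, AffineLayer.eval, Pi.add_apply, Matrix.mulVec, dotProduct,
      ← (copyEquiv η k).sum_comp, Fintype.sum_prod_type]
    simp [hidden_eq, state, outputLayer, Finset.mul_sum, mul_assoc, mul_left_comm]

theorem emitted_toLoopedNet_succ (t : ℕ) : (B.toLoopedNet δ k).emitted (t + 1) =
    (B.toLoopedNet δ k).emitted t ++
      if 0 < B.state δ k (t + 1) (.inl 1) then [decide (0 < B.state δ k (t + 1) (.inl 2))]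
      else [] := by
  rw [← state_toLoopedNet, ← state_toLoopedNet, LoopedNet.emitted]
  split_ifs with h1 h2 h2
  exacts [rfl, absurd h1 h2, absurd h2 h1, (List.append_nil _).symm]

end TernaryBlock

theorem max_mul_natCast_sub {c : ℝ} (hc : 0 ≤ c) (a b : ℕ) :
    max (c * ((a : ℝ) - b)) 0 = c * ((a - b : ℕ) : ℝ) := by
  rcases le_total a b with h | h
  · have : (a : ℝ) ≤ b := by exact_mod_cast h
    rw [Nat.sub_eq_zero_of_le h, Nat.cast_zero, mul_zero,
      max_eq_right (mul_nonpos_of_nonneg_of_nonpos hc (sub_nonpos.2 this))]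
  · rw [← Nat.cast_sub h, max_eq_left (by positivity)]

namespace CounterInstr

section Simulation

variable (C : List CounterInstr) (m : ℕ)

/-- The coordinates of a configuration: the counters and the addresses. -/
abbrev Coord := Fin m ⊕ Fin (C.length + 1)

/-- The hidden neurons: the detector of the initial state `0`, the counters, the addresses, and
the addresses at which a zero test succeeds. -/
abbrev Neuron := Unit ⊕ Fin m ⊕ Fin (C.length + 1) ⊕ Fin (C.length + 1)

/-- The counter that is tested and decremented at an address. -/
def decrAt (q : ℕ) : Option ℕ := C[q]?.bind decr

/-- The bit that is output at an address. -/
def outAt (q : ℕ) : Option Bool := C[q]?.bind out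

/-- The network that simulates a machine. -/
def simulator : TernaryBlock (Coord C m) (Neuron C m) where
  input
    | .inl _, .inl _ => 0
    | .inl _, .inr _ => -1
    | .inr (.inl j), .inl j' => if j = j' then 1 else 0
    | .inr (.inl j), .inr q => if decrAt C q = some ↑j then -1 else 0
    | .inr (.inr (.inl _)), .inl _ => 0
    | .inr (.inr (.inl q)), .inr q' => if q = q' then 1 else 0
    | .inr (.inr (.inr q)), .inl j => if decrAt C q = some ↑j then -1 else 0
    | .inr (.inr (.inr q)), .inr q' => if q = q' ∧ (decrAt C q).isSome then 1 else 0
  bias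
    | .inl _ => 1
    | .inr _ => 0
  output
    | .inl c, .inr (.inr (.inl q)) => ![if (q : ℕ) = C.length then 1 else 0,
        if (outAt C q).isSome then 1 else 0, if outAt C q = some true then 1 else 0] c
    | .inr (.inl j), .inr (.inl j') => if j = j' then 1 else 0
    | .inr (.inl j), .inr (.inr (.inl q)) => if C[q]?.bind incr = some ↑j then 1 else 0
    | .inr (.inr q'), .inl _ => if (q' : ℕ) = 0 then 1 else 0
    | .inr (.inr q'), .inr (.inr (.inl q)) => if C[q]?.map next = some ↑q' then 1 else 0
    | .inr (.inr q'), .inr (.inr (.inr q)) => if C[q]?.map onZero = C[q]?.map next then 0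
        else if C[q]?.map onZero = some ↑q' then 1
        else if C[q]?.map next = some ↑q' then -1 else 0
    | _, _ => 0

/-- The encoding of a configuration at the scale `l`. -/
def encode (l : ℝ) (c : ℕ × (ℕ → ℕ)) : Coord C m → ℝ
  | .inl j => l * c.2 j
  | .inr q => if c.1 = q then l else 0

/-- The values of the hidden neurons on an encoded configuration, up to scale. -/
def neuronVal (c : ℕ × (ℕ → ℕ)) : Neuron C m → ℕ
  | .inl _ => 0
  | .inr (.inl j) => c.2 j - if decrAt C c.1 = some ↑j then 1 else 0
  | .inr (.inr (.inl q)) => if c.1 = q then 1 else 0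
  | .inr (.inr (.inr q)) => if c.1 = q ∧ (decrAt C c.1).map c.2 = some 0 then 1 else 0

variable {C m} {δ l : ℝ} {k : ℕ}

theorem sum_signType_decrAt (hm : ∀ i ∈ C, i.CountersLT m) (q : ℕ) (f : ℕ → ℝ) :
    ∑ j : Fin m, ((if decrAt C q = some ↑j then -1 else 0 : SignType) : ℝ) * f j =
      -((decrAt C q).map f).getD 0 := by
  rcases h : decrAt C q with _ | r
  · simp
  · obtain ⟨i, hi, hr⟩ := Option.bind_eq_some_iff.1 h
    have hrm : r < m := (hm i (List.mem_of_getElem? hi)).1 r hr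
    rw [Finset.sum_eq_single ⟨r, hrm⟩ (fun j _ hj => ?_) (by simp)]
    · simp
    · rw [if_neg (by simpa [Fin.ext_iff, eq_comm] using hj)]
      simp

theorem hidden_simulator (hδ : 0 < δ) (hl : 1 ≤ l) (hm : ∀ i ∈ C, i.CountersLT m)
    (q : Fin (C.length + 1)) (σ : ℕ → ℕ) (h : Neuron C m) :
    (simulator C m).hidden δ (encode C m l (q, σ)) h = δ * l * neuronVal C m (q, σ) h := by
  have hδl : 0 ≤ δ * l := by positivity
  have of_eq (a b : ℕ) (hab : neuronVal C m (q, σ) h = a - b)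
      (hsum : ∑ i, (simulator C m).input h i * encode C m l (q, σ) i + (simulator C m).bias h =
        l * ((a : ℝ) - b)) :
      (simulator C m).hidden δ (encode C m l (q, σ)) h = δ * l * neuronVal C m (q, σ) h := by
    rw [TernaryBlock.hidden, hsum, ← mul_assoc, max_mul_natCast_sub hδl, hab]
  rcases h with _ | j | q' | q'
  · have : δ * (1 - l) ≤ 0 := mul_nonpos_of_nonneg_of_nonpos hδ.le (sub_nonpos.2 hl)
    simpa [TernaryBlock.hidden, simulator, encode, neuronVal, Fin.val_inj, neg_add_eq_sub]
      using this
  · refine of_eq (σ j) (if decrAt C q = some ↑j then 1 else 0) rfl ?_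
    simp only [simulator, Nat.succ_eq_add_one, Nat.reduceAdd, Fin.getElem?_fin,
      Fin.val_eq_zero_iff, Option.map_eq_some_iff, encode, Fin.val_inj, Fintype.sum_sum_type,
      signType_coe_ite, SignType.coe_one, SignType.coe_zero, ite_mul, one_mul, zero_mul,
      Finset.sum_ite_eq, Finset.mem_univ, ↓reduceIte, SignType.coe_neg, mul_ite, neg_mul, mul_zero,
      add_zero, Nat.cast_ite, Nat.cast_one, CharP.cast_eq_zero]
    split_ifs <;> ring
  · refine of_eq (if q = q' then 1 else 0) 0 (by simp [neuronVal, Fin.val_inj]) ?_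
    simp [simulator, encode, signType_coe_ite, Fin.val_inj, eq_comm (a := q')]
  · refine of_eq (if q = q' ∧ (decrAt C q).isSome then 1 else 0)
      (((decrAt C q').map σ).getD 0) ?_ ?_
    · rcases eq_or_ne q q' with rfl | hq
      · rcases h : decrAt C q with _ | r
        · simp [neuronVal, h]
        · rcases hr : σ r with _ | n <;> simp [neuronVal, h, hr]
      · simp [neuronVal, hq, Fin.val_inj]
    · have hdecr := sum_signType_decrAt hm q' fun r => l * σ r
      simp only [simulator, encode, Fintype.sum_sum_type, hdecr]
      rcases eq_or_ne q q' with rfl | hq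
      · rcases decrAt C q with _ | r <;>
          simp [signType_coe_ite, Fin.val_inj, neg_add_eq_sub, mul_sub]
      · rcases decrAt C q' with _ | r <;> simp [hq, hq.symm, Fin.val_inj]

theorem sum_output_inl (q : Fin (C.length + 1)) (σ : ℕ → ℕ) (c : Fin 3) :
    ∑ h, ((simulator C m).output (.inl c) h : ℝ) * neuronVal C m (q, σ) h =
      ![if (q : ℕ) = C.length then 1 else 0, if (outAt C q).isSome then 1 else 0,
        if outAt C q = some true then 1 else 0] c := by
  simp only [simulator, neuronVal, Fintype.sum_sum_type, Fin.val_inj]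
  fin_cases c <;> simp [signType_coe_ite]

theorem sum_output_inr {q : Fin (C.length + 1)} {i : CounterInstr} (hi : C[(q : ℕ)]? = some i)
    (σ : ℕ → ℕ) (l : ℝ) (j : Coord C m) :
    l * ∑ h, ((simulator C m).output (.inr j) h : ℝ) * neuronVal C m (q, σ) h =
      encode C m l (i.exec σ) j := by
  have hdecr : decrAt C q = i.decr := by simp [decrAt, hi]
  rcases j with j | q' <;>
    simp only [simulator, neuronVal, encode, exec, Fintype.sum_sum_type, Fin.val_inj, hdecr]
  · simp [signType_coe_ite, hi]
  · simp only [Finset.univ_unique, PUnit.default_eq_unit, Fin.val_eq_zero_iff, signType_coe_ite,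
      SignType.coe_one, SignType.coe_zero, CharP.cast_eq_zero, mul_zero, Finset.sum_const_zero,
      zero_mul, Fin.getElem?_fin, Option.map_eq_some_iff, Nat.cast_ite, Nat.cast_one, mul_ite,
      mul_one, Finset.sum_ite_eq, Finset.mem_univ, ↓reduceIte, hi, Option.some.injEq,
      exists_eq_left', SignType.coe_neg, ite_and, Option.map_some, zero_add]
    split_ifs <;> grind

theorem state_simulator_one (hδ : 0 < δ) (j : Fin 3 ⊕ Coord C m) :
    (simulator C m).state δ k 1 j = k * δ ^ 2 * (simulator C m).output j (.inl ()) := by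
  simp only [TernaryBlock.state, simulator, Nat.succ_eq_add_one, Nat.reduceAdd, Fin.getElem?_fin,
    Fin.val_eq_zero_iff, Option.map_eq_some_iff, TernaryBlock.hidden, mul_zero,
    Finset.sum_const_zero, zero_add, Fintype.sum_sum_type, Finset.univ_unique,
    PUnit.default_eq_unit, SignType.coe_one, mul_one, hδ.le, sup_of_le_left, Finset.sum_singleton,
    SignType.coe_zero, max_self, add_zero]
  ring

theorem state_simulator_succ (hδ : 0 < δ) (hl : 1 ≤ l) (hm : ∀ i ∈ C, i.CountersLT m) {t : ℕ}
    {q : Fin (C.length + 1)} {σ : ℕ → ℕ}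
    (ht : ∀ j, (simulator C m).state δ k t (.inr j) = encode C m l (q, σ) j)
    (j : Fin 3 ⊕ Coord C m) : (simulator C m).state δ k (t + 1) j =
      k * δ ^ 2 * l * ∑ h, ((simulator C m).output j h : ℝ) * neuronVal C m (q, σ) h := by
  simp only [TernaryBlock.state, ht, hidden_simulator hδ hl hm, Finset.mul_sum]
  exact Finset.sum_congr rfl fun _ _ => by ring

theorem Steps.simulate (hδ : 0 < δ) (hk : 1 ≤ k * δ ^ 2) (hm : ∀ i ∈ C, i.CountersLT m)
    {o : List Bool} {c : ℕ × (ℕ → ℕ)} (h : Steps C (0, 0) o c) :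
    ∃ n l, 1 ≤ l ∧ (∀ j, (simulator C m).state δ k n (.inr j) = encode C m l c j) ∧
      ((simulator C m).toLoopedNet δ k).emitted n = o ∧
      ∀ t ≤ n, ¬ 0 < (simulator C m).state δ k t (.inl 0) := by
  induction h with
  | refl =>
    refine ⟨1, k * δ ^ 2, hk, fun j => ?_, ?_, fun t ht => ?_⟩
    · rw [state_simulator_one hδ]
      rcases j with j | q <;> simp [simulator, encode, signType_coe_ite, eq_comm (a := 0)]
    · rw [TernaryBlock.emitted_toLoopedNet_succ, state_simulator_one hδ]
      simp [simulator, LoopedNet.emitted]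
    · interval_cases t
      · simp [TernaryBlock.state]
      · rw [state_simulator_one hδ]
        simp [simulator]
  | @step o q σ i _ hi ih =>
    obtain ⟨n, l, hl, hstate, hout, hhalt⟩ := ih
    have hq : q < C.length := (List.getElem?_eq_some_iff.1 hi).1
    have hl' : 1 ≤ k * δ ^ 2 * l := one_le_mul_of_one_le_of_one_le hk hl
    have hpos : 0 < k * δ ^ 2 * l := one_pos.trans_le hl'
    have hnext := state_simulator_succ (k := k) (q := ⟨q, by omega⟩) hδ hl hm hstate
    refine ⟨n + 1, _, hl', fun j => ?_, ?_, fun t ht => ?_⟩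
    · rw [hnext, sum_output_inr hi]
    · rw [TernaryBlock.emitted_toLoopedNet_succ, hout, hnext, hnext, sum_output_inl,
        sum_output_inl]
      simp only [mul_pos_iff_of_pos_left hpos]
      have hq' : outAt C q = i.out := by simp [outAt, hi]
      rcases h : i.out with _ | _ | _ <;> simp [hq', h]
    · rcases ht.lt_or_eq with ht | rfl
      · exact hhalt t (Nat.le_of_lt_succ ht)
      · rw [hnext, sum_output_inl]
        simp [hq.ne]

theorem outputs_simulator (hδ : 0 < δ) (hk : 1 ≤ k * δ ^ 2) (hm : ∀ i ∈ C, i.CountersLT m)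
    {s : List Bool} {σ : ℕ → ℕ} (h : Steps C (0, 0) s (C.length, σ)) :
    ((simulator C m).toLoopedNet δ k).Outputs s := by
  obtain ⟨n, l, hl, hstate, hout, hhalt⟩ := h.simulate hδ hk hm
  have halt_eq (t : ℕ) : ((simulator C m).toLoopedNet δ k).halt t =
      (simulator C m).state δ k t (.inl 0) :=
    TernaryBlock.state_toLoopedNet _ _ _ t (.inl 0)
  refine ⟨n, ?_, fun t _ ht => halt_eq t ▸ hhalt t ht, hout⟩
  rw [halt_eq, state_simulator_succ (q := Fin.last _) hδ hl hm hstate, sum_output_inl]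
  simpa using one_pos.trans_le (one_le_mul_of_one_le_of_one_le hk hl)

end Simulation
end CounterInstr

theorem exists_neuralComplexity_le_mul_sq {δ M : ℝ} (hδ : 0 < δ) (hM : δ ≤ M)
    {S : ℕ → List Bool} (hS : Computable S) :
    ∃ c : ℕ, ∀ p, neuralComplexity δ M (S p) ≤ (c * (p + 1) ^ 2 : ℕ) := by
  obtain ⟨m, d, hC⟩ := CounterInstr.exists_steps_of_computable hS
  obtain ⟨k, hk⟩ := exists_nat_ge (1 / δ ^ 2)
  rw [div_le_iff₀ (by positivity)] at hk
  refine ⟨2 * ((2 * d + m + 5) * k + 1) * (d + m + 5), fun p => ?_⟩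
  obtain ⟨C, hlen, hm, σ, hsteps⟩ := hC p
  let B := CounterInstr.simulator C m
  have hη : Fintype.card (CounterInstr.Neuron C m) ≤ (p + 1) * (2 * d + m + 5) := by
    simp only [Fintype.card_sum, Fintype.card_unique, hlen, Fintype.card_fin]
    nlinarith
  have hκ : Fintype.card (CounterInstr.Coord C m) + 4 ≤ (p + 1) * (d + m + 5) := by
    simp only [Fintype.card_sum, Fintype.card_fin, hlen]
    nlinarith
  calc neuralComplexity δ M (S p)
      ≤ (B.toLoopedNet δ k).block.numNonzero :=
        sInf_le ⟨_, B.isFixedPrecision_toLoopedNet δ k hδ hM,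
          CounterInstr.outputs_simulator hδ hk hm hsteps, rfl⟩
    _ ≤ _ := Nat.cast_le.2 ((B.numNonzero_toLoopedNet_le δ k).trans ?_)
  calc 2 * (Fintype.card (CounterInstr.Neuron C m) * k + 1) *
        (Fintype.card (CounterInstr.Coord C m) + 4)
      ≤ 2 * ((p + 1) * (2 * d + m + 5) * k + (p + 1)) * ((p + 1) * (d + m + 5)) := by
        gcongr
        omega
    _ = _ := by ring

/-! ### Networks of constant width -/

namespace LoopedNet

variable {N N' : LoopedNet} {s s' : List Bool}

theorem Outputs.of_channels_eq (h : N.Outputs s)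
    (hc : ∀ t c (hc : c < 3), N'.state t ⟨c, hc.trans_le N'.three_le⟩ =
      N.state t ⟨c, hc.trans_le N.three_le⟩) : N'.Outputs s := by
  have halt_eq (t : ℕ) : N'.halt t = N.halt t := hc t 0 (by omega)
  have emit_eq (t : ℕ) : N'.emit t = N.emit t := hc t 1 (by omega)
  have bit_eq (t : ℕ) : N'.bit t = N.bit t := hc t 2 (by omega)
  have emitted_eq (t : ℕ) : N'.emitted t = N.emitted t := by
    induction t with
    | zero => rfl
    | succ t ih => simp only [emitted, ih, emit_eq, bit_eq]
  simpa only [Outputs, halt_eq, emitted_eq] using h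

theorem Outputs.unique (h : N.Outputs s) (h' : N.Outputs s') : s = s' := by
  obtain ⟨τ, hτ, hlt, rfl⟩ := h
  obtain ⟨τ', hτ', hlt', rfl⟩ := h'
  rcases lt_trichotomy τ τ' with h | rfl | h
  · exact absurd hτ (hlt' _ (by omega) h)
  · rfl
  · exact absurd hτ' (hlt _ (by omega) h)

theorem state_succ (N : LoopedNet) (t : ℕ) : N.state (t + 1) = N.block.eval (N.state t) :=
  Function.iterate_succ_apply' _ _ _

end LoopedNet

theorem AffineLayer.eval_eq_zero {m n : ℕ} {A : AffineLayer m n} (h : A.numNonzero = 0)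
    (x : Fin m → ℝ) : A.eval x = 0 := by
  obtain ⟨hW, hb⟩ := Nat.add_eq_zero_iff.1 h
  rw [Finset.card_eq_zero, Finset.filter_eq_empty_iff] at hW hb
  have weight_eq : A.weight = 0 := Matrix.ext fun i j => by simpa using hW (Finset.mem_univ (i, j))
  have bias_eq : A.bias = 0 := funext fun i => by simpa using hb (Finset.mem_univ i)
  simp [AffineLayer.eval, weight_eq, bias_eq]

namespace FeedforwardNet

/-- The number of hidden layers. -/
def depth : {m n : ℕ} → FeedforwardNet m n → ℕ
  | _, _, last _ => 0
  | _, _, cons _ f => f.depth + 1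

theorem exists_eval_eq_const {m n : ℕ} (f : FeedforwardNet m n) (h : f.numNonzero ≤ f.depth) :
    ∃ y, ∀ x, f.eval x = y := by
  induction f with
  | last A => exact ⟨0, A.eval_eq_zero (Nat.le_zero.1 h)⟩
  | cons A f ih =>
    rw [numNonzero, depth] at h
    by_cases hf : f.numNonzero ≤ f.depth
    · obtain ⟨y, hy⟩ := ih hf
      exact ⟨y, fun x => hy _⟩
    · refine ⟨f.eval fun _ => max 0 0, fun x => ?_⟩
      rw [eval, A.eval_eq_zero (by omega)]
      rfl

end FeedforwardNet

theorem LoopedNet.Outputs.depth_lt_numNonzero {N : LoopedNet} {s : List Bool} (h : N.Outputs s)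
    (hs : s ≠ []) : N.block.depth < N.block.numNonzero := by
  by_contra! hle
  obtain ⟨y, hy⟩ := N.block.exists_eval_eq_const hle
  have state_eq (t : ℕ) : N.state (t + 1) = y := by rw [state_succ, hy]
  obtain ⟨_ | τ, hτ, hlt, rfl⟩ := h
  · exact hs rfl
  · refine hlt 1 le_rfl (by omega) ?_
    rwa [halt, state_eq] at hτ ⊢

namespace FeedforwardNet

variable {D : ℕ}

/-- The network of constant width with the layers `A 0, …, A n`. -/
def ofFn : ℕ → (ℕ → AffineLayer D D) → FeedforwardNet D D
  | 0, A => .last (A 0)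
  | n + 1, A => .cons (A 0) (ofFn n fun l => A (l + 1))

theorem isFixedPrecision_ofFn {δ M : ℝ} {n : ℕ} {A : ℕ → AffineLayer D D} :
    (ofFn n A).IsFixedPrecision δ M ↔ ∀ l ≤ n, (A l).IsFixedPrecision δ M := by
  induction n generalizing A with
  | zero => simp [ofFn, IsFixedPrecision]
  | succ n ih =>
    rw [ofFn, IsFixedPrecision, ih]
    exact ⟨fun h l hl => by rcases l with _ | l; exacts [h.1, h.2 l (by omega)],
      fun h => ⟨h 0 (by omega), fun l hl => h _ (by omega)⟩⟩

theorem finite_ofFn {S : Set (AffineLayer D D)} (hS : S.Finite) (n : ℕ) :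
    {f | ∃ A, (∀ l ≤ n, A l ∈ S) ∧ f = ofFn n A}.Finite := by
  induction n with
  | zero =>
    refine (hS.image .last).subset ?_
    rintro _ ⟨A, hA, rfl⟩
    exact ⟨A 0, hA 0 le_rfl, rfl⟩
  | succ n ih =>
    refine (hS.image2 .cons ih).subset ?_
    rintro _ ⟨A, hA, rfl⟩
    exact ⟨A 0, hA 0 (by omega), _, ⟨_, fun l hl => hA (l + 1) (by omega), rfl⟩, rfl⟩

end FeedforwardNet

theorem exists_pequiv_covering {α β : Type*} [Fintype α] (S : Finset β)
    (hS : S.card ≤ Fintype.card α) : ∃ σ : α ≃. β, ∀ b ∈ S, ∃ a, σ a = some b := by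
  classical
  obtain ⟨e⟩ := Function.Embedding.nonempty_of_card_le (α := S) (by simpa using hS)
  have mem_partialInv (a : α) (b : S) : e.toFun.partialInv a = some b ↔ e b = a :=
    (e.injective.isPartialInv b a)
  refine ⟨⟨fun a => (e.toFun.partialInv a).map Subtype.val,
    fun b => if hb : b ∈ S then some (e ⟨b, hb⟩) else none, fun a b => ?_⟩, fun b hb => ?_⟩
  · by_cases hb : b ∈ S <;>
      simp only [Option.map_eq_some_iff, mem_partialInv, Subtype.exists,
        exists_and_right, exists_eq_right, hb, dif_pos, dif_neg, not_false_eq_true,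
        Option.some.injEq, exists_true_left, reduceCtorEq, IsEmpty.exists_iff]
  · exact ⟨e ⟨b, hb⟩, Option.map_eq_some_iff.2 ⟨⟨b, hb⟩, (mem_partialInv _ _).2 rfl, rfl⟩⟩

theorem zero_mem_fixedPrecisionValues {δ M : ℝ} (hM : 0 ≤ M) : 0 ∈ fixedPrecisionValues δ M :=
  ⟨⟨0, by simp⟩, by simp [hM]⟩

section Relabel

open Matrix

variable {D a b : ℕ}

theorem toMatrix_mulVec_apply (σ : Fin D ≃. Fin a) (x : Fin a → ℝ) (d : Fin D) :
    (σ.toMatrix *ᵥ x) d = (σ d).elim 0 x := by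
  cases h : σ d <;> simp [Matrix.mulVec, dotProduct, PEquiv.toMatrix_apply, h]

theorem toMatrix_symm_mulVec_toMatrix_mulVec {σ : Fin D ≃. Fin a} {x : Fin a → ℝ}
    (hx : ∀ i, x i ≠ 0 → ∃ d, σ d = some i) : σ.symm.toMatrix *ᵥ (σ.toMatrix *ᵥ x) = x := by
  ext i
  rw [toMatrix_mulVec_apply]
  cases h : σ.symm i with
  | none =>
    by_contra hi
    obtain ⟨d, hd⟩ := hx i (Ne.symm hi)
    rw [← PEquiv.eq_some_iff, h] at hd
    cases hd
  | some d =>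
    simp [toMatrix_mulVec_apply, (PEquiv.eq_some_iff σ).1 h]

namespace AffineLayer

/-- The layer `A` with its inputs and outputs renamed along partial bijections: channel `d` of the
new layer plays the role of channel `σ d` (of channel `τ d` on the output side), and is disconnected
if that is `none`. -/
noncomputable def relabel (A : AffineLayer a b) (σ : Fin D ≃. Fin a) (τ : Fin D ≃. Fin b) :
    AffineLayer D D where
  weight := (τ.toMatrix : Matrix (Fin D) (Fin b) ℝ) * A.weight *
    (σ.symm.toMatrix : Matrix (Fin a) (Fin D) ℝ)
  bias := τ.toMatrix *ᵥ A.bias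

theorem eval_relabel (A : AffineLayer a b) {σ : Fin D ≃. Fin a} (τ : Fin D ≃. Fin b)
    {x : Fin a → ℝ} (hx : ∀ i, x i ≠ 0 → ∃ d, σ d = some i) :
    (A.relabel σ τ).eval (σ.toMatrix *ᵥ x) = τ.toMatrix *ᵥ A.eval x := by
  simp only [eval, relabel, ← mulVec_mulVec, toMatrix_symm_mulVec_toMatrix_mulVec hx, mulVec_add]

theorem relabel_weight_apply (A : AffineLayer a b) (σ : Fin D ≃. Fin a) (τ : Fin D ≃. Fin b)
    (d d' : Fin D) : (A.relabel σ τ).weight d d' =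
      (τ d).elim 0 fun i => (σ d').elim 0 (A.weight i) := by
  simp only [relabel]
  rw [PEquiv.mul_toMatrix_apply, PEquiv.symm_symm]
  cases hσ : σ d' <;> cases hτ : τ d <;> simp [PEquiv.toMatrix_mul_apply, hτ]

theorem relabel_bias_apply (A : AffineLayer a b) (σ : Fin D ≃. Fin a) (τ : Fin D ≃. Fin b)
    (d : Fin D) : (A.relabel σ τ).bias d = (τ d).elim 0 A.bias :=
  toMatrix_mulVec_apply τ A.bias d

theorem numNonzero_relabel_le (A : AffineLayer a b) (σ : Fin D ≃. Fin a) (τ : Fin D ≃. Fin b) :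
    (A.relabel σ τ).numNonzero ≤ A.numNonzero := by
  refine Nat.add_le_add
    (Finset.card_le_card_of_forall_subsingleton
      (fun p q => τ p.1 = some q.1 ∧ σ p.2 = some q.2) ?_ ?_)
    (Finset.card_le_card_of_forall_subsingleton (fun d i => τ d = some i) ?_ ?_)
  · rintro ⟨d, d'⟩ h
    rw [Finset.mem_filter_univ, relabel_weight_apply] at h
    cases hτ : τ d <;> cases hσ : σ d' <;> simp_all
  · rintro q - p ⟨-, hp⟩ p' ⟨-, hp'⟩
    exact Prod.ext (τ.inj hp.1 hp'.1) (σ.inj hp.2 hp'.2)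
  · intro d h
    rw [Finset.mem_filter_univ, relabel_bias_apply] at h
    cases hτ : τ d <;> simp_all
  · rintro i - d ⟨-, hd⟩ d' ⟨-, hd'⟩
    exact τ.inj hd hd'

theorem IsFixedPrecision.relabel {δ M : ℝ} {A : AffineLayer a b} (hA : A.IsFixedPrecision δ M)
    (hM : 0 ≤ M) (σ : Fin D ≃. Fin a) (τ : Fin D ≃. Fin b) :
    (A.relabel σ τ).IsFixedPrecision δ M := by
  refine ⟨fun d d' => ?_, fun d => ?_⟩
  · rw [relabel_weight_apply]
    cases τ d
    · exact zero_mem_fixedPrecisionValues hM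
    cases σ d'
    exacts [zero_mem_fixedPrecisionValues hM, hA.1 _ _]
  · rw [relabel_bias_apply]
    cases τ d
    exacts [zero_mem_fixedPrecisionValues hM, hA.2 _]

/-- The output coordinates with a non-zero incoming weight or bias; the layer maps every other
coordinate identically to `0`. -/
noncomputable def active (A : AffineLayer a b) : Finset (Fin b) :=
  (Finset.univ.filter fun ij : Fin b × Fin a => A.weight ij.1 ij.2 ≠ 0).image Prod.fst ∪
    Finset.univ.filter fun i : Fin b => A.bias i ≠ 0

theorem card_active_le (A : AffineLayer a b) : A.active.card ≤ A.numNonzero :=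
  (Finset.card_union_le _ _).trans (Nat.add_le_add_right Finset.card_image_le _)

theorem mem_active (A : AffineLayer a b) {x : Fin a → ℝ} {i : Fin b} (h : A.eval x i ≠ 0) :
    i ∈ A.active := by
  contrapose! h
  obtain ⟨weight_eq, bias_eq⟩ : (∀ j, A.weight i j = 0) ∧ A.bias i = 0 := by
    simpa [active] using h
  simp [eval, mulVec, dotProduct, weight_eq, bias_eq]

end AffineLayer

namespace FeedforwardNet

/-- The active coordinates of the last layer. -/
noncomputable def active : {m n : ℕ} → FeedforwardNet m n → Finset (Fin n)
  | _, _, last A => A.active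
  | _, _, cons _ f => f.active

theorem card_active_le (f : FeedforwardNet a b) : f.active.card ≤ f.numNonzero := by
  induction f with
  | last A => exact A.card_active_le
  | cons A f ih => exact ih.trans (Nat.le_add_left _ _)

theorem mem_active (f : FeedforwardNet a b) {x : Fin a → ℝ} {i : Fin b} (h : f.eval x i ≠ 0) :
    i ∈ f.active := by
  induction f with
  | last A => exact A.mem_active h
  | cons A f ih => exact ih h

theorem exists_ofFn {δ M : ℝ} (hM : 0 ≤ M) (f : FeedforwardNet a b)
    (hf : f.IsFixedPrecision δ M) (hD : f.numNonzero ≤ D) (σ : Fin D ≃. Fin a)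
    (τ : Fin D ≃. Fin b) :
    ∃ A : ℕ → AffineLayer D D, (ofFn f.depth A).IsFixedPrecision δ M ∧
      (ofFn f.depth A).numNonzero ≤ f.numNonzero ∧
      ∀ x, (∀ i, x i ≠ 0 → ∃ d, σ d = some i) →
        (ofFn f.depth A).eval (σ.toMatrix *ᵥ x) = τ.toMatrix *ᵥ f.eval x := by
  induction f with
  | last A =>
    exact ⟨fun _ => A.relabel σ τ, AffineLayer.IsFixedPrecision.relabel hf hM σ τ,
      A.numNonzero_relabel_le σ τ, fun x hx => A.eval_relabel τ hx⟩
  | cons A f ih =>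
    rw [numNonzero] at hD
    obtain ⟨ρ, hρ⟩ := exists_pequiv_covering (α := Fin D) A.active
      (A.card_active_le.trans (by rw [Fintype.card_fin]; omega))
    obtain ⟨B, hB, hcard, heval⟩ := ih hf.2 (by omega) ρ τ
    refine ⟨fun | 0 => A.relabel σ ρ | l + 1 => B l, ?_⟩
    change (cons _ (ofFn f.depth B)).IsFixedPrecision δ M ∧
      (cons _ (ofFn f.depth B)).numNonzero ≤ _ ∧ _
    refine ⟨⟨hf.1.relabel hM σ ρ, hB⟩,
      Nat.add_le_add (A.numNonzero_relabel_le σ ρ) hcard, fun x hx => ?_⟩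
    have relu_relabel : (fun d => max ((A.relabel σ ρ).eval (σ.toMatrix *ᵥ x) d) 0) =
        ρ.toMatrix *ᵥ fun i => max (A.eval x i) 0 := by
      ext d
      rw [A.eval_relabel ρ hx, toMatrix_mulVec_apply, toMatrix_mulVec_apply]
      cases ρ d <;> simp
    rw [eval, ← heval, ← relu_relabel]
    · rfl
    · exact fun i hi => hρ i (A.mem_active (x := x) fun h => hi (by simp [h]))

end FeedforwardNet

namespace LoopedNet

theorem exists_pequiv_fixing_channels (N : LoopedNet) {m : ℕ} (hm : N.block.numNonzero ≤ m) :
    ∃ σ : Fin (m + 3) ≃. Fin N.n, (∀ i ∈ N.block.active, ∃ d, σ d = some i) ∧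
      ∀ c : Fin 3, σ (c.castLE (by omega)) = some (c.castLE N.three_le) := by
  let channels : Finset (Fin N.n) := Finset.univ.map (Fin.castLEEmb N.three_le)
  obtain ⟨σ, hσ⟩ := exists_pequiv_covering (α := Fin (m + 3)) (N.block.active ∪ channels) (by
    have := N.block.card_active_le
    have := Finset.card_union_le N.block.active channels
    simp only [channels, Finset.card_map, Finset.card_univ, Fintype.card_fin] at this ⊢
    omega)
  choose ch hch using fun c : Fin 3 =>
    hσ (c.castLE N.three_le)
      (Finset.mem_union_right _ (Finset.mem_map_of_mem _ (Finset.mem_univ c)))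
  have ch_injective : Function.Injective ch := fun c c' h =>
    Fin.castLE_injective _ (Option.some.inj ((hch c).symm.trans (h ▸ hch c')))
  obtain ⟨π, hπ⟩ := Equiv.Perm.exists_extending_pair (Fin.castLE (Nat.le_add_left 3 m)) ch
    (Fin.castLE_injective _) ch_injective
  refine ⟨π.toPEquiv.trans σ, fun i hi => ?_, fun c => ?_⟩
  · obtain ⟨d, hd⟩ := hσ i (Finset.mem_union_left _ hi)
    exact ⟨π.symm d, by simp [PEquiv.trans, hd]⟩
  · simp [PEquiv.trans, hπ, hch]

theorem exists_ofFn {δ M : ℝ} (hM : 0 ≤ M) (N : LoopedNet)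
    (hN : N.block.IsFixedPrecision δ M) {m : ℕ} (hm : N.block.numNonzero ≤ m) :
    ∃ A : ℕ → AffineLayer (m + 3) (m + 3),
      (FeedforwardNet.ofFn N.block.depth A).IsFixedPrecision δ M ∧
      (FeedforwardNet.ofFn N.block.depth A).numNonzero ≤ N.block.numNonzero ∧
      ∀ s, N.Outputs s →
        LoopedNet.Outputs ⟨m + 3, by omega, FeedforwardNet.ofFn N.block.depth A⟩ s := by
  obtain ⟨σ, σ_active, σ_channel⟩ := N.exists_pequiv_fixing_channels hm
  obtain ⟨A, hA, hcard, heval⟩ := N.block.exists_ofFn hM hN (hm.trans (by omega)) σ σ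
  refine ⟨A, hA, hcard, fun s hs => ?_⟩
  set N' : LoopedNet := ⟨m + 3, by omega, FeedforwardNet.ofFn N.block.depth A⟩
  have support_covered (t : ℕ) (i : Fin N.n) (hi : N.state t i ≠ 0) : ∃ d, σ d = some i := by
    rcases t with _ | t
    · exact absurd rfl hi
    · exact σ_active i (N.block.mem_active (x := N.state t) (by rwa [state_succ] at hi))
  have state_eq (t : ℕ) : N'.state t = σ.toMatrix *ᵥ N.state t := by
    induction t with
    | zero => exact (mulVec_zero _).symm
    | succ t ih => rw [state_succ, state_succ, ← heval _ (support_covered t), ← ih]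
  refine hs.of_channels_eq fun t c hc => ?_
  rw [state_eq, toMatrix_mulVec_apply]
  exact congrArg (Option.elim · 0 (N.state t)) (σ_channel ⟨c, hc⟩)

end LoopedNet

end Relabel

section Unbounded

variable {δ M : ℝ}

theorem neuralComplexity_le_iff {s : List Bool} {m : ℕ} :
    neuralComplexity δ M s ≤ m ↔ ∃ N : LoopedNet, N.block.IsFixedPrecision δ M ∧ N.Outputs s ∧
      N.block.numNonzero ≤ m := by
  constructor
  · intro h
    obtain ⟨_, ⟨N, hN, hs, rfl⟩, hlt⟩ := sInf_lt_iff.1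
      (h.trans_lt (by exact_mod_cast m.lt_succ_self : (m : ℕ∞) < (m + 1 : ℕ)))
    exact ⟨N, hN, hs, Nat.lt_succ_iff.1 (by exact_mod_cast hlt)⟩
  · rintro ⟨N, hN, hs, hm⟩
    exact sInf_le_of_le ⟨N, hN, hs, rfl⟩ (by exact_mod_cast hm)

theorem mul_intCast_mem_Icc_iff (hδ : 0 < δ) (hM : δ ≤ M) (k : ℤ) :
    δ * k ∈ Set.Icc (-M) M ↔ |k| ≤ (⌊M / δ⌋₊ : ℤ) := by
  rw [Set.mem_Icc, ← abs_le, abs_mul, abs_of_pos hδ, ← le_div_iff₀' hδ, Int.abs_eq_natAbs,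
    Nat.cast_le, Nat.le_floor_iff (div_nonneg (hδ.le.trans hM) hδ.le), Nat.cast_natAbs,
    Int.cast_abs]

theorem mem_fixedPrecisionValues_iff (hδ : 0 < δ) (hM : δ ≤ M) {v : ℝ} :
    v ∈ fixedPrecisionValues δ M ↔
      ∃ w : Fin (2 * ⌊M / δ⌋₊ + 1), v = δ * (((w : ℕ) : ℤ) - (⌊M / δ⌋₊ : ℤ) : ℤ) := by
  constructor
  · rintro ⟨⟨k, rfl⟩, h⟩
    have hk := abs_le.1 ((mul_intCast_mem_Icc_iff hδ hM k).1 h)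
    refine ⟨⟨(k + ⌊M / δ⌋₊).toNat, by omega⟩, ?_⟩
    congr 2
    dsimp only
    omega
  · rintro ⟨w, rfl⟩
    exact ⟨⟨_, rfl⟩, (mul_intCast_mem_Icc_iff hδ hM _).2 (abs_le.2 (by omega))⟩

theorem finite_fixedPrecisionValues (hδ : 0 < δ) (hM : δ ≤ M) :
    (fixedPrecisionValues δ M).Finite :=
  (Set.finite_range fun w : Fin (2 * ⌊M / δ⌋₊ + 1) =>
    δ * (((w : ℕ) : ℤ) - (⌊M / δ⌋₊ : ℤ) : ℤ)).subset fun _ hv =>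
      let ⟨w, hw⟩ := (mem_fixedPrecisionValues_iff hδ hM).1 hv
      ⟨w, hw.symm⟩

theorem finite_isFixedPrecision (hδ : 0 < δ) (hM : δ ≤ M) (a b : ℕ) :
    {A : AffineLayer a b | A.IsFixedPrecision δ M}.Finite := by
  have hV := finite_fixedPrecisionValues hδ hM
  refine (((Set.Finite.pi' fun _ => Set.Finite.pi' fun _ => hV).prod
    (Set.Finite.pi' fun _ => hV)).image fun p => ⟨.of p.1, p.2⟩).subset ?_
  exact fun A hA => ⟨(A.weight, A.bias), hA, rfl⟩

theorem finite_neuralComplexity_le (hδ : 0 < δ) (hM : δ ≤ M) (m : ℕ) :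
    {s | neuralComplexity δ M s ≤ m}.Finite := by
  have hlayers := finite_isFixedPrecision hδ hM (m + 3) (m + 3)
  refine ((Set.finite_singleton []).union ((Set.finite_Iio m).biUnion fun d _ =>
    (FeedforwardNet.finite_ofFn hlayers d).biUnion fun f _ => Set.Subsingleton.finite
      (s := {s | LoopedNet.Outputs ⟨m + 3, by omega, f⟩ s})
      fun _ h _ h' => h.unique h')).subset fun s hs => ?_
  by_cases hnil : s = []
  · exact .inl hnil
  obtain ⟨N, hN, hout, hm⟩ := neuralComplexity_le_iff.1 hs
  obtain ⟨A, hA, -, hA_out⟩ := N.exists_ofFn (hδ.le.trans hM) hN hm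
  refine .inr (Set.mem_biUnion ((hout.depth_lt_numNonzero hnil).trans_le hm)
    (Set.mem_biUnion ⟨A, ?_, rfl⟩ (hA_out s hout)))
  exact FeedforwardNet.isFixedPrecision_ofFn.1 hA

theorem exists_lt_neuralComplexity (hδ : 0 < δ) (hM : δ ≤ M) (m : ℕ) :
    ∃ s, (m : ℕ∞) < neuralComplexity δ M s := by
  by_contra! h
  exact Set.infinite_univ ((finite_neuralComplexity_le hδ hM m).subset fun s _ => h s)

theorem exists_computable_lt {F : List Bool → ℕ∞} (hF : IsComputableENat F)
    (hunb : ∀ m : ℕ, ∃ s, (m : ℕ∞) < F s) {g : ℕ → ℕ} (hg : Computable g) :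
    ∃ S : ℕ → List Bool, Computable S ∧ ∀ p, (g p : ℕ∞) < F (S p) := by
  obtain ⟨φ, hφ, hφF⟩ := hF
  let str (j : ℕ) : List Bool := (Encodable.decode j).getD []
  have hstr : Computable str := Computable.option_getD Computable.decode (.const [])
  obtain ⟨test, htest, test_iff⟩ : ∃ test : ℕ → ℕ → Bool, Computable₂ test ∧
      ∀ p j, test p j = true ↔ (g p : ℕ∞) < F (str j) := by
    refine ⟨fun p j => Option.casesOn (φ (str j)) true fun c => decide (g p < c), ?_,
      fun p j => ?_⟩
    · refine Computable.option_casesOn (hφ.comp (hstr.comp .snd)) (.const true) ?_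
      exact (PrimrecRel.decide Primrec.nat_lt).to_comp.comp
        (hg.comp (Computable.fst.comp .fst)) .snd
    · rw [← hφF]
      cases h : φ (str j) <;> simp [h, extNat]
  have exists_test (p : ℕ) : ∃ j, test p j = true := by
    obtain ⟨s, hs⟩ := hunb (g p)
    exact ⟨Encodable.encode s, (test_iff _ _).2 (by simpa [str] using hs)⟩
  let idx (p : ℕ) : ℕ := Nat.find (exists_test p)
  have computable_idx : Computable idx :=
    Computable.find (P := fun p j => test p j = true)
      (ComputablePred.computable_iff.2 ⟨_, htest, rfl⟩) exists_test
  exact ⟨fun p => str (idx p), hstr.comp computable_idx,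
    fun p => (test_iff _ _).1 (Nat.find_spec (exists_test p))⟩

theorem not_isComputableENat_neuralComplexity (hδ : 0 < δ) (hM : δ ≤ M) :
    ¬ IsComputableENat (neuralComplexity δ M) := by
  intro h
  have computable_cube : Computable fun p => (p + 1) * ((p + 1) * (p + 1)) :=
    (Primrec.nat_mul.comp .succ (Primrec.nat_mul.comp .succ .succ)).to_comp
  obtain ⟨S, hS, hlt⟩ := exists_computable_lt h (exists_lt_neuralComplexity hδ hM) computable_cube
  obtain ⟨c, hc⟩ := exists_neuralComplexity_le_mul_sq hδ hM hS
  have key : (c + 1) * ((c + 1) * (c + 1)) < c * (c + 1) ^ 2 := by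
    exact_mod_cast (hlt c).trans_le (hc c)
  nlinarith

end Unbounded

/-! ### Signs of integer polynomials at a computable real number -/

theorem encode_int_natCast (n : ℕ) : Encodable.encode (n : ℤ) = 2 * n := rfl

theorem encode_int_negSucc (n : ℕ) : Encodable.encode (Int.negSucc n) = 2 * n + 1 := rfl

theorem primrec_int_toNat : Primrec Int.toNat := by
  have : Primrec fun z : ℤ => bif (Encodable.encode z).bodd then 0 else (Encodable.encode z).div2 :=
    Primrec.cond (Primrec.nat_bodd.comp .encode) (.const 0) (Primrec.nat_div2.comp .encode)
  refine this.of_eq fun z => ?_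
  cases z with
  | ofNat n => simp [encode_int_natCast]
  | negSucc n => simp [encode_int_negSucc]

theorem primrec_int_neg_toNat : Primrec fun z : ℤ => (-z).toNat := by
  have : Primrec fun z : ℤ =>
      bif (Encodable.encode z).bodd then (Encodable.encode z).div2 + 1 else 0 :=
    Primrec.cond (Primrec.nat_bodd.comp .encode)
      (Primrec.succ.comp (Primrec.nat_div2.comp .encode)) (.const 0)
  refine this.of_eq fun z => ?_
  cases z with
  | ofNat n => simp [encode_int_natCast]
  | negSucc n => simp [encode_int_negSucc, Int.neg_negSucc]

theorem primrec₂_int_natCast_sub_natCast : Primrec₂ fun a b : ℕ => (a : ℤ) - b := by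
  refine Primrec.encode_iff.1 ?_
  have : Primrec fun x : ℕ × ℕ =>
      if x.2 ≤ x.1 then 2 * (x.1 - x.2) else 2 * (x.2 - x.1 - 1) + 1 :=
    Primrec.ite (Primrec.nat_le.comp .snd .fst)
      (Primrec.nat_mul.comp (.const 2) (Primrec.nat_sub.comp .fst .snd))
      (Primrec.succ.comp (Primrec.nat_mul.comp (.const 2) (Primrec.nat_sub.comp
        (Primrec.nat_sub.comp .snd .fst) (.const 1))))
  refine this.of_eq fun ⟨a, b⟩ => ?_
  dsimp only
  split_ifs with hba
  · rw [← Nat.cast_sub hba, encode_int_natCast]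
  · have : (a : ℤ) - b = Int.negSucc (b - a - 1) := by omega
    rw [this, encode_int_negSucc]

theorem primrec₂_int_add : Primrec₂ fun a b : ℤ => a + b := by
  refine (primrec₂_int_natCast_sub_natCast.comp
    (Primrec.nat_add.comp (primrec_int_toNat.comp .fst) (primrec_int_toNat.comp .snd))
    (Primrec.nat_add.comp (primrec_int_neg_toNat.comp .fst)
      (primrec_int_neg_toNat.comp .snd))).of_eq fun x => ?_
  dsimp only
  omega

theorem primrec₂_int_mul : Primrec₂ fun a b : ℤ => a * b := by
  have toNat_fst : Primrec fun x : ℤ × ℤ => x.1.toNat := primrec_int_toNat.comp .fst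
  have toNat_snd : Primrec fun x : ℤ × ℤ => x.2.toNat := primrec_int_toNat.comp .snd
  have neg_fst : Primrec fun x : ℤ × ℤ => (-x.1).toNat := primrec_int_neg_toNat.comp .fst
  have neg_snd : Primrec fun x : ℤ × ℤ => (-x.2).toNat := primrec_int_neg_toNat.comp .snd
  refine (primrec₂_int_natCast_sub_natCast.comp
    (Primrec.nat_add.comp (Primrec.nat_mul.comp toNat_fst toNat_snd)
      (Primrec.nat_mul.comp neg_fst neg_snd))
    (Primrec.nat_add.comp (Primrec.nat_mul.comp toNat_fst neg_snd)
      (Primrec.nat_mul.comp neg_fst toNat_snd))).of_eq fun x => ?_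
  have hsub (z : ℤ) : (z.toNat : ℤ) - ((-z).toNat : ℤ) = z := by omega
  conv_rhs => rw [← hsub x.1, ← hsub x.2]
  push_cast
  ring

section CoeffList
open Polynomial

/-- The integer polynomial with a given list of coefficients, constant term first; trailing zeros
are allowed. -/
noncomputable def listPoly (p : List ℤ) : ℤ[X] := p.foldr (fun c f => C c + X * f) 0

theorem listPoly_cons (c : ℤ) (p : List ℤ) : listPoly (c :: p) = C c + X * listPoly p := rfl

theorem coeff_listPoly : ∀ (p : List ℤ) (i : ℕ), (listPoly p).coeff i = p.getD i 0
  | [], i => by simp [listPoly]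
  | c :: p, 0 => by simp [listPoly_cons]
  | c :: p, i + 1 => by
    rw [listPoly_cons, coeff_add, coeff_X_mul, coeff_listPoly p, coeff_C_succ, zero_add,
      List.getD_cons_succ]

theorem listPoly_surjective : Function.Surjective listPoly := by
  intro f
  refine ⟨(List.range (f.natDegree + 1)).map f.coeff, ?_⟩
  ext i
  rw [coeff_listPoly, List.getD_eq_getElem?_getD, List.getElem?_map]
  by_cases h : i < f.natDegree + 1
  · simp [List.getElem?_range h]
  · rw [List.getElem?_eq_none (by simpa using h), coeff_eq_zero_of_natDegree_lt (by omega)]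
    rfl

/-- Addition of polynomials given as in `listPoly`. -/
def listAdd (p q : List ℤ) : List ℤ :=
  (List.range (p.length + q.length)).map fun i => p.getD i 0 + q.getD i 0

theorem listPoly_listAdd (p q : List ℤ) : listPoly (listAdd p q) = listPoly p + listPoly q := by
  ext i
  rw [coeff_add, coeff_listPoly, coeff_listPoly, coeff_listPoly, listAdd,
    List.getD_eq_getElem?_getD, List.getElem?_map]
  by_cases h : i < p.length + q.length
  · simp [List.getElem?_range h]
  · rw [List.getElem?_eq_none (by simpa using h), List.getD_eq_default _ _ (by omega),
      List.getD_eq_default _ _ (by omega)]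
    rfl

theorem primrec₂_listAdd : Primrec₂ listAdd := by
  refine Primrec.list_map (Primrec.list_range.comp (Primrec.nat_add.comp
    (Primrec.list_length.comp .fst) (Primrec.list_length.comp .snd))) ?_
  exact primrec₂_int_add.comp
    ((Primrec.list_getD 0).comp (Primrec.fst.comp .fst) .snd)
    ((Primrec.list_getD 0).comp (Primrec.snd.comp .fst) .snd)

/-- Scalar multiplication of a polynomial given as in `listPoly`. -/
def listSmul (c : ℤ) (p : List ℤ) : List ℤ := p.map fun x => c * x

theorem listPoly_listSmul (c : ℤ) (p : List ℤ) : listPoly (listSmul c p) = C c * listPoly p := by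
  induction p with
  | nil => simp [listSmul, listPoly]
  | cons a p ih =>
    rw [listSmul, List.map_cons, listPoly_cons, ← listSmul, ih, listPoly_cons, C_mul]
    ring

theorem primrec₂_listSmul : Primrec₂ listSmul :=
  Primrec.list_map .snd (primrec₂_int_mul.comp (Primrec.fst.comp .fst) .snd)

/-- Multiplication of polynomials given as in `listPoly`. -/
def listMul (p q : List ℤ) : List ℤ :=
  p.foldr (fun c f => listAdd (listSmul c q) (0 :: f)) []

theorem listPoly_listMul (p q : List ℤ) : listPoly (listMul p q) = listPoly p * listPoly q := by
  induction p with
  | nil => simp [listMul, listPoly]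
  | cons a p ih =>
    rw [listMul, List.foldr_cons, ← listMul, listPoly_listAdd, listPoly_listSmul, listPoly_cons, ih,
      listPoly_cons, C_0]
    ring

theorem primrec₂_listMul : Primrec₂ listMul := by
  refine Primrec.list_foldr (α := List ℤ × List ℤ)
    (h := fun x s => listAdd (listSmul s.1 x.2) (0 :: s.2)) Primrec.fst (.const []) ?_
  exact primrec₂_listAdd.comp
    (primrec₂_listSmul.comp (Primrec.fst.comp .snd) (Primrec.snd.comp .fst))
    (Primrec.list_cons.comp (.const 0) (Primrec.snd.comp .snd))

theorem listPoly_eq_zero_iff {p : List ℤ} : listPoly p = 0 ↔ ∀ c ∈ p, c = 0 := by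
  induction p with
  | nil => simp [listPoly]
  | cons a p ih =>
    rw [List.forall_mem_cons, ← ih, listPoly_cons]
    refine ⟨fun h => ?_, fun ⟨ha, hp⟩ => by simp [ha, hp]⟩
    have ha : a = 0 := by simpa using congrArg (coeff · 0) h
    exact ⟨ha, by simpa [ha] using h⟩

theorem exists_map_eq_C_mul (f : ℚ[X]) :
    ∃ c : ℤ, c ≠ 0 ∧ ∃ u : ℤ[X], u.map (algebraMap ℤ ℚ) = C (c : ℚ) * f := by
  obtain ⟨c, hc, hcf⟩ := IsLocalization.integerNormalization_spec (nonZeroDivisors ℤ) f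
  refine ⟨c, nonZeroDivisors.ne_zero hc, _, hcf.trans ?_⟩
  simp [zsmul_eq_mul]

theorem exists_aeval_eq_zero_iff (x : ℝ) : ∃ q : ℤ[X], ∀ p : ℤ[X],
    aeval x p = 0 ↔ ∃ c : ℤ, c ≠ 0 ∧ ∃ u : ℤ[X], C c * p = u * q := by
  have aeval_map (p : ℤ[X]) : aeval x (p.map (algebraMap ℤ ℚ)) = aeval x p :=
    aeval_map_algebraMap ℚ x p
  obtain ⟨g, hg⟩ := (inferInstance :
    (RingHom.ker (aeval x : ℚ[X] →ₐ[ℚ] ℝ)).IsPrincipal).principal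
  have aeval_eq_zero_iff (f : ℚ[X]) : aeval x f = 0 ↔ g ∣ f := by
    rw [← RingHom.mem_ker, hg, ← Ideal.mem_span_singleton]
  obtain ⟨d, hd, q, hq⟩ := exists_map_eq_C_mul g
  refine ⟨q, fun p => ⟨fun hp => ?_, ?_⟩⟩
  · obtain ⟨f, hf⟩ := (aeval_eq_zero_iff _).1 ((aeval_map p).trans hp)
    obtain ⟨e, he, u, hu⟩ := exists_map_eq_C_mul f
    refine ⟨d * e, mul_ne_zero hd he, u,
      map_injective (algebraMap ℤ ℚ) (algebraMap ℤ ℚ).injective_int ?_⟩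
    rw [Polynomial.map_mul, Polynomial.map_mul, hu, hq, hf]
    simp only [eq_intCast, Polynomial.map_mul, Polynomial.map_intCast, Int.cast_mul, map_intCast]
    ring
  · rintro ⟨c, hc, u, hu⟩
    have hq0 : aeval x q = 0 := by
      rw [← aeval_map, hq, aeval_eq_zero_iff]
      exact dvd_mul_left _ _
    have hcp := congrArg (aeval x) hu
    rw [map_mul, map_mul, hq0, mul_zero, aeval_C] at hcp
    exact (mul_eq_zero.1 hcp).resolve_left (by simpa using hc)

end CoeffList

section Sign

open Polynomial Filter Topology

/-- The value at `x` of the polynomial with coefficients `f c`, where `c` runs over a list. With `f`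
the positive or the negative part, it splits an integer polynomial into two that are monotone on
`[0, ∞)`. -/
noncomputable def natEval (f : ℤ → ℕ) (x : ℝ) (p : List ℤ) : ℝ :=
  p.foldr (fun c s => f c + x * s) 0

/-- Numerator and denominator of the value at `x / N` of the polynomial with coefficients `f c`,
where `c` runs over a list: a version of `natEval` in pure natural-number arithmetic. -/
def fracEval (f : ℤ → ℕ) (x N : ℕ) (p : List ℤ) : ℕ × ℕ :=
  p.foldr (fun c s => (f c * (s.2 * N) + x * s.1, s.2 * N)) (0, 1)

theorem natEval_cons (f : ℤ → ℕ) (x : ℝ) (c : ℤ) (p : List ℤ) :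
    natEval f x (c :: p) = f c + x * natEval f x p := rfl

theorem fracEval_cons (f : ℤ → ℕ) (x N : ℕ) (c : ℤ) (p : List ℤ) :
    fracEval f x N (c :: p) = (f c * ((fracEval f x N p).2 * N) + x * (fracEval f x N p).1,
      (fracEval f x N p).2 * N) := rfl

theorem fracEval_snd (f : ℤ → ℕ) (x N : ℕ) (p : List ℤ) :
    (fracEval f x N p).2 = N ^ p.length := by
  induction p with
  | nil => rfl
  | cons c p ih => rw [fracEval_cons, ih, List.length_cons, pow_succ]

theorem fracEval_fst (f : ℤ → ℕ) (x N : ℕ) (hN : N ≠ 0) (p : List ℤ) :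
    ((fracEval f x N p).1 : ℝ) = natEval f (x / N) p * N ^ p.length := by
  have : (N : ℝ) ≠ 0 := Nat.cast_ne_zero.2 hN
  induction p with
  | nil => simp [fracEval, natEval]
  | cons c p ih =>
    rw [fracEval_cons, natEval_cons, fracEval_snd, List.length_cons]
    push_cast
    rw [ih]
    field_simp
    ring

theorem natEval_nonneg (f : ℤ → ℕ) {x : ℝ} (hx : 0 ≤ x) (p : List ℤ) : 0 ≤ natEval f x p := by
  induction p with
  | nil => exact le_rfl
  | cons c p ih => exact add_nonneg (Nat.cast_nonneg _) (mul_nonneg hx ih)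

theorem natEval_mono (f : ℤ → ℕ) {x y : ℝ} (hx : 0 ≤ x) (hxy : x ≤ y) (p : List ℤ) :
    natEval f x p ≤ natEval f y p := by
  induction p with
  | nil => exact le_rfl
  | cons c p ih =>
    exact add_le_add_right (mul_le_mul hxy ih (natEval_nonneg f hx p) (hx.trans hxy)) _

theorem continuous_natEval (f : ℤ → ℕ) (p : List ℤ) : Continuous fun x => natEval f x p := by
  induction p with
  | nil => exact continuous_const
  | cons c p ih => exact continuous_const.add (continuous_id.mul ih)

theorem aeval_listPoly_eq (x : ℝ) (p : List ℤ) :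
    aeval x (listPoly p) = natEval Int.toNat x p - natEval (fun z => (-z).toNat) x p := by
  induction p with
  | nil => simp [listPoly, natEval]
  | cons c p ih =>
    have hc : (c : ℝ) = (c.toNat : ℝ) - ((-c).toNat : ℝ) := by
      exact_mod_cast (by omega : c = (c.toNat : ℤ) - ((-c).toNat : ℤ))
    rw [listPoly_cons, natEval_cons, natEval_cons, map_add, map_mul, aeval_X, aeval_C, ih]
    simp only [algebraMap_int_eq, eq_intCast]
    rw [hc]
    ring

theorem primrec_fracEval {f : ℤ → ℕ} (hf : Primrec f) :
    Primrec fun y : (ℕ × ℕ) × List ℤ => fracEval f y.1.1 y.1.2 y.2 := by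
  have denom : Primrec fun z : ((ℕ × ℕ) × List ℤ) × ℤ × ℕ × ℕ => z.2.2.2 * z.1.1.2 :=
    Primrec.nat_mul.comp (Primrec.snd.comp (Primrec.snd.comp .snd))
      (Primrec.snd.comp (Primrec.fst.comp .fst))
  refine Primrec.list_foldr (α := (ℕ × ℕ) × List ℤ)
    (h := fun y s => (f s.1 * (s.2.2 * y.1.2) + y.1.1 * s.2.1, s.2.2 * y.1.2)) .snd
    (.const (0, 1)) ?_
  exact Primrec.pair (Primrec.nat_add.comp
    (Primrec.nat_mul.comp (hf.comp (Primrec.fst.comp .snd)) denom)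
    (Primrec.nat_mul.comp (Primrec.fst.comp (Primrec.fst.comp .fst))
      (Primrec.fst.comp (Primrec.snd.comp .snd)))) denom

theorem primrec_two_pow : Primrec fun n : ℕ => 2 ^ n := by
  refine (Primrec.nat_rec₁ 1 (f := fun _ k => 2 * k)
    (Primrec.nat_mul.comp (.const 2) .snd)).of_eq fun n => ?_
  induction n with
  | zero => rfl
  | succ n ih => rw [pow_succ', ← ih]

theorem toNat_sub_one_mem_Icc {y : ℝ} {z : ℤ} (hy : 0 ≤ y) (hyz : |y - z| ≤ 1) :
    ((z.toNat - 1 : ℕ) : ℝ) ∈ Set.Icc (y - 2) y := by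
  have hmax : ((z.toNat - 1 : ℕ) : ℝ) = max (z - 1 : ℝ) 0 := by
    exact_mod_cast (by omega : ((z.toNat - 1 : ℕ) : ℤ) = max (z - 1) 0)
  rw [abs_le] at hyz
  rw [hmax]
  exact ⟨le_max_of_le_left (by linarith), max_le (by linarith) hy⟩

theorem toNat_add_one_mem_Icc {y : ℝ} {z : ℤ} (hy : 0 ≤ y) (hyz : |y - z| ≤ 1) :
    ((z.toNat + 1 : ℕ) : ℝ) ∈ Set.Icc y (y + 2) := by
  have hmax : ((z.toNat + 1 : ℕ) : ℝ) = max (z + 1 : ℝ) 1 := by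
    exact_mod_cast (by omega : ((z.toNat + 1 : ℕ) : ℤ) = max (z + 1) 1)
  rw [abs_le] at hyz
  rw [hmax]
  exact ⟨le_max_of_le_left (by linarith), max_le (by linarith) (by linarith)⟩

theorem tendsto_div_two_pow {x : ℝ} {k : ℕ → ℕ} {C : ℝ} (hk : ∀ n, |k n - x * 2 ^ n| ≤ C) :
    Tendsto (fun n => (k n : ℝ) / 2 ^ n) atTop (𝓝 x) := by
  refine tendsto_sub_nhds_zero_iff.1 (squeeze_zero_norm (a := fun n => C / 2 ^ n) (fun n => ?_)
    (tendsto_const_nhds.div_atTop (tendsto_pow_atTop_atTop_of_one_lt one_lt_two)))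
  have hpow : (0 : ℝ) < 2 ^ n := by positivity
  rw [Real.norm_eq_abs, le_div_iff₀ hpow, ← abs_of_pos hpow, ← abs_mul, abs_of_pos hpow, sub_mul,
    div_mul_cancel₀ _ hpow.ne']
  exact hk n

theorem IsComputableReal.exists_dyadic_bounds {x : ℝ} (hx : IsComputableReal x) (hx0 : 0 ≤ x) :
    ∃ lo hi : ℕ → ℕ, Computable lo ∧ Computable hi ∧
      (∀ n, (lo n : ℝ) / 2 ^ n ≤ x) ∧ (∀ n, x ≤ (hi n : ℝ) / 2 ^ n) ∧
      Tendsto (fun n => (lo n : ℝ) / 2 ^ n) atTop (𝓝 x) ∧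
      Tendsto (fun n => (hi n : ℝ) / 2 ^ n) atTop (𝓝 x) := by
  obtain ⟨a, ha, hxa⟩ := hx
  have scaled (n : ℕ) : |x * 2 ^ n - a n| ≤ 1 := by
    have hpow : (0 : ℝ) < 2 ^ n := by positivity
    have hfactor : x * 2 ^ n - a n = (x - a n / 2 ^ n) * 2 ^ n := by field_simp
    rw [hfactor, abs_mul, abs_of_pos hpow, ← le_div_iff₀ hpow]
    exact hxa n
  have lo_mem (n : ℕ) := toNat_sub_one_mem_Icc (by positivity) (scaled n)
  have hi_mem (n : ℕ) := toNat_add_one_mem_Icc (by positivity) (scaled n)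
  refine ⟨fun n => (a n).toNat - 1, fun n => (a n).toNat + 1,
    Primrec.pred.to_comp.comp (primrec_int_toNat.to_comp.comp ha),
    Primrec.succ.to_comp.comp (primrec_int_toNat.to_comp.comp ha),
    fun n => (div_le_iff₀ (by positivity)).2 (lo_mem n).2,
    fun n => (le_div_iff₀ (by positivity)).2 (hi_mem n).1,
    tendsto_div_two_pow (C := 2) fun n => abs_le.2 ?_,
    tendsto_div_two_pow (C := 2) fun n => abs_le.2 ?_⟩
  · exact ⟨by linarith [(lo_mem n).1], by linarith [(lo_mem n).2]⟩
  · exact ⟨by linarith [(hi_mem n).1], by linarith [(hi_mem n).2]⟩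

/-- The test whether the negative part of a polynomial at `hi / 2 ^ n` is less than its positive
part at `lo / 2 ^ n`, which makes the polynomial positive on the interval between the two points. -/
def posCheck (lo hi n : ℕ) (p : List ℤ) : Bool :=
  decide ((fracEval (fun z => (-z).toNat) hi (2 ^ n) p).1 < (fracEval Int.toNat lo (2 ^ n) p).1)

theorem posCheck_eq_true_iff {lo hi n : ℕ} {p : List ℤ} : posCheck lo hi n p = true ↔
    natEval (fun z => (-z).toNat) (hi / 2 ^ n) p < natEval Int.toNat (lo / 2 ^ n) p := by
  rw [posCheck, decide_eq_true_iff, ← Nat.cast_lt (α := ℝ), fracEval_fst _ _ _ (by positivity),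
    fracEval_fst _ _ _ (by positivity), mul_lt_mul_iff_of_pos_right (by positivity)]
  simp only [Nat.cast_pow, Nat.cast_ofNat]

theorem exists_posCheck_iff {x : ℝ} (hx : 0 ≤ x) {lo hi : ℕ → ℕ}
    (hlo : ∀ n, (lo n : ℝ) / 2 ^ n ≤ x) (hhi : ∀ n, x ≤ (hi n : ℝ) / 2 ^ n)
    (tendsto_lo : Tendsto (fun n => (lo n : ℝ) / 2 ^ n) atTop (𝓝 x))
    (tendsto_hi : Tendsto (fun n => (hi n : ℝ) / 2 ^ n) atTop (𝓝 x)) (p : List ℤ) :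
    (∃ n, posCheck (lo n) (hi n) n p = true) ↔ 0 < aeval x (listPoly p) := by
  simp only [posCheck_eq_true_iff]
  rw [aeval_listPoly_eq, sub_pos]
  constructor
  · rintro ⟨n, hn⟩
    exact (natEval_mono _ hx (hhi n) p).trans_lt
      (hn.trans_le (natEval_mono _ (by positivity) (hlo n) p))
  · intro h
    exact ((((continuous_natEval _ p).tendsto x).comp tendsto_hi).eventually_lt
      (((continuous_natEval _ p).tendsto x).comp tendsto_lo) h).exists

theorem computable_posCheck {lo hi : ℕ → ℕ} (hlo : Computable lo) (hhi : Computable hi) :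
    Computable₂ fun n p => posCheck (lo n) (hi n) n p := by
  have value {f : ℤ → ℕ} (hf : Primrec f) {k : ℕ → ℕ} (hk : Computable k) :
      Computable fun y : ℕ × List ℤ => (fracEval f (k y.1) (2 ^ y.1) y.2).1 :=
    (Computable.fst.comp ((primrec_fracEval hf).to_comp.comp
      (((hk.comp .fst).pair (primrec_two_pow.to_comp.comp .fst)).pair .snd))).of_eq fun _ => rfl
  exact ((PrimrecRel.decide Primrec.nat_lt).to_comp.comp
    (value primrec_int_neg_toNat hhi) (value primrec_int_toNat hlo)).of_eq fun _ => rfl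

/-- The test whether the multiplier `w.1` and the cofactor `w.2` show, in the sense of
`exists_aeval_eq_zero_iff`, that `p` vanishes wherever `q` does. -/
def zeroCheck (q p : List ℤ) (w : ℤ × List ℤ) : Bool :=
  decide (w.1 ≠ 0) &&
    (listAdd (listSmul w.1 p) (listSmul (-1) (listMul w.2 q))).all fun c => decide (c = 0)

theorem zeroCheck_eq_true_iff {q p : List ℤ} {w : ℤ × List ℤ} : zeroCheck q p w = true ↔
    w.1 ≠ 0 ∧ C w.1 * listPoly p = listPoly w.2 * listPoly q := by
  rw [zeroCheck, Bool.and_eq_true, decide_eq_true_iff, List.all_eq_true]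
  simp only [decide_eq_true_iff, ← listPoly_eq_zero_iff]
  simp [listPoly_listAdd, listPoly_listSmul, listPoly_listMul, ← sub_eq_add_neg, sub_eq_zero]

theorem exists_zeroCheck_iff {q p : List ℤ} : (∃ w, zeroCheck q p w = true) ↔
    ∃ c : ℤ, c ≠ 0 ∧ ∃ u : ℤ[X], C c * listPoly p = u * listPoly q := by
  simp only [zeroCheck_eq_true_iff, Prod.exists, listPoly_surjective.exists, exists_and_left]

theorem primrec₂_zeroCheck (q : List ℤ) : Primrec₂ (zeroCheck q) := by
  have multiplier : Primrec fun y : List ℤ × ℤ × List ℤ => y.2.1 := Primrec.fst.comp .snd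
  have difference : Primrec fun y : List ℤ × ℤ × List ℤ =>
      listAdd (listSmul y.2.1 y.1) (listSmul (-1) (listMul y.2.2 q)) :=
    primrec₂_listAdd.comp (primrec₂_listSmul.comp multiplier .fst)
      (primrec₂_listSmul.comp (.const (-1))
        (primrec₂_listMul.comp (Primrec.snd.comp .snd) (.const q)))
  have all_zero : Primrec fun p : List ℤ => p.all fun c => decide (c = 0) :=
    (PrimrecPred.forall_mem_list (Primrec.eq.comp .id (.const (0 : ℤ)))).decide.of_eq fun p =>
      Bool.eq_iff_iff.2 (by simp)
  exact Primrec.and.comp (Primrec.eq.comp multiplier (.const 0)).not.decide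
    (all_zero.comp difference)

theorem rePred_exists_nat {α : Type*} [Primcodable α] {c : α → ℕ → Bool} (hc : Computable₂ c) :
    REPred fun a => ∃ n, c a n = true := by
  refine (Partrec.dom_re (Partrec.rfind hc.partrec₂)).of_eq fun a => ?_
  simp

theorem rePred_exists {α β : Type*} [Primcodable α] [Primcodable β] {c : α → β → Bool}
    (hc : Computable₂ c) : REPred fun a => ∃ b, c a b = true := by
  let search (a : α) (n : ℕ) : Bool := ((Encodable.decode n : Option β).map (c a)).getD false
  have computable_search : Computable₂ search :=
    Computable.option_getD (Computable.option_map (Computable.decode.comp .snd)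
      (hc.comp (Computable.fst.comp .fst) .snd)) (.const false)
  have search_iff (a : α) (n : ℕ) :
      search a n = true ↔ ∃ b, (Encodable.decode n : Option β) = some b ∧ c a b = true := by
    cases h : (Encodable.decode n : Option β) <;> simp [search, h]
  refine (rePred_exists_nat computable_search).of_eq fun a => ?_
  simp only [search_iff]
  exact ⟨fun ⟨_, b, _, hb⟩ => ⟨b, hb⟩, fun ⟨b, hb⟩ => ⟨_, b, Encodable.encodek b, hb⟩⟩

theorem rePred_or {α : Type*} [Primcodable α] {p q : α → Prop} (hp : REPred p) (hq : REPred q) :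
    REPred fun a => p a ∨ q a := by
  obtain ⟨k, hk, k_spec⟩ := Partrec.merge' hp hq
  exact hk.dom_re.of_eq fun a => (k_spec a).2.trans (by simp [Part.assert])

theorem exists_computable_pos {x : ℝ} (hx : 0 ≤ x) (hc : IsComputableReal x) :
    ∃ pos : List ℤ → Bool, Computable pos ∧ ∀ p, pos p = true ↔ 0 < aeval x (listPoly p) := by
  obtain ⟨lo, hi, computable_lo, computable_hi, lo_le, le_hi, tendsto_lo, tendsto_hi⟩ :=
    hc.exists_dyadic_bounds hx
  obtain ⟨q, hq⟩ := exists_aeval_eq_zero_iff x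
  obtain ⟨q, rfl⟩ := listPoly_surjective q
  have pos_iff (p : List ℤ) := exists_posCheck_iff hx lo_le le_hi tendsto_lo tendsto_hi p
  have rePred_pos : REPred fun p => 0 < aeval x (listPoly p) :=
    (rePred_exists_nat (c := fun p n => posCheck (lo n) (hi n) n p)
      ((computable_posCheck computable_lo computable_hi).comp .snd .fst)).of_eq pos_iff
  have rePred_neg : REPred fun p => 0 < aeval x (listPoly (listSmul (-1) p)) :=
    rePred_pos.comp (primrec₂_listSmul.to_comp.comp (.const (-1)) .id)
  have rePred_zero : REPred fun p => aeval x (listPoly p) = 0 :=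
    (rePred_exists (primrec₂_zeroCheck q).to_comp).of_eq fun p =>
      exists_zeroCheck_iff.trans (hq _).symm
  have rePred_not_pos : REPred fun p => ¬ 0 < aeval x (listPoly p) := by
    refine (rePred_or rePred_neg rePred_zero).of_eq fun p => ?_
    simp [listPoly_listSmul, le_iff_lt_or_eq]
  obtain ⟨pos, computable_pos, hpos⟩ := ComputablePred.computable_iff.1
    (ComputablePred.computable_iff_re_compl_re'.2 ⟨rePred_pos, rePred_not_pos⟩)
  exact ⟨pos, computable_pos, fun p => (iff_of_eq (congrFun hpos p)).symm⟩

end Sign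

/-! ### Search through coded networks -/

namespace FeedforwardNet

variable {D : ℕ}

/-- The values of the neurons of a network of constant width with the layers `A 0, A 1, …` before
the layer `l`, on the input `x`. -/
noncomputable def hiddenState (A : ℕ → AffineLayer D D) (x : Fin D → ℝ) : ℕ → Fin D → ℝ
  | 0 => x
  | l + 1 => fun i => max ((A l).eval (hiddenState A x l) i) 0

theorem hiddenState_shift (A : ℕ → AffineLayer D D) (x : Fin D → ℝ) (l : ℕ) :
    hiddenState (fun l => A (l + 1)) (hiddenState A x 1) l = hiddenState A x (l + 1) := by
  induction l with
  | zero => rfl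
  | succ l ih =>
    rw [hiddenState, ih]
    rfl

theorem eval_ofFn (n : ℕ) (A : ℕ → AffineLayer D D) (x : Fin D → ℝ) :
    (ofFn n A).eval x = (A n).eval (hiddenState A x n) := by
  induction n generalizing A x with
  | zero => rfl
  | succ n ih => exact (ih _ _).trans (congrArg _ (hiddenState_shift A x n))

theorem numNonzero_ofFn (n : ℕ) (A : ℕ → AffineLayer D D) :
    (ofFn n A).numNonzero = ∑ l ∈ Finset.range (n + 1), (A l).numNonzero := by
  induction n generalizing A with
  | zero => simp [ofFn, numNonzero]
  | succ n ih => rw [ofFn, numNonzero, ih, Finset.sum_range_succ' _ (n + 1), add_comm]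

theorem ofFn_congr {n : ℕ} {A B : ℕ → AffineLayer D D} (h : ∀ l ≤ n, A l = B l) :
    ofFn n A = ofFn n B := by
  induction n generalizing A B with
  | zero => rw [ofFn, ofFn, h 0 le_rfl]
  | succ n ih => rw [ofFn, ofFn, h 0 (by omega), ih fun l hl => h (l + 1) (by omega)]

end FeedforwardNet

section Combinators

variable {α σ : Type*} [Primcodable α] [Primcodable σ]

theorem computable_of_recursion {F : α → ℕ → σ} {h : α → ℕ × σ → σ} {n : α → ℕ}
    (base : Computable fun a => F a 0) (step : ∀ a k, F a (k + 1) = h a (k, F a k))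
    (hh : Computable₂ h) (hn : Computable n) : Computable fun a => F a (n a) := by
  refine (Computable.nat_rec hn base hh).of_eq fun a => ?_
  induction n a with
  | zero => rfl
  | succ k ih => rw [step, ← ih]

theorem computable_map_range {n : α → ℕ} {f : α → ℕ → σ} (hn : Computable n)
    (hf : Computable₂ f) : Computable fun a => (List.range (n a)).map (f a) :=
  computable_of_recursion (F := fun a k => (List.range k).map (f a))
    (h := fun a y => y.2 ++ [f a y.1]) (.const [])
    (fun a k => by rw [List.range_succ, List.map_append]; rfl)
    (Computable.list_concat.comp (Computable.snd.comp .snd)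
      (hf.comp .fst (Computable.fst.comp .snd))) hn

theorem computable_sum_range {n : α → ℕ} {f : α → ℕ → ℕ} (hn : Computable n)
    (hf : Computable₂ f) : Computable fun a => ∑ i ∈ Finset.range (n a), f a i :=
  computable_of_recursion (F := fun a k => ∑ i ∈ Finset.range k, f a i)
    (h := fun a y => y.2 + f a y.1) (.const 0) (fun a k => Finset.sum_range_succ (f a) k)
    (Primrec.nat_add.to_comp.comp (Computable.snd.comp .snd)
      (hf.comp .fst (Computable.fst.comp .snd))) hn

end Combinators

/-- Codes of looped networks of constant width together with a number of iterations: the width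
minus `3`, the index of the last layer, the list of parameters as multiples of the resolution
shifted by `K`, and the number of iterations. -/
abbrev NetCode (K : ℕ) := ℕ × ℕ × List (Fin (2 * K + 1)) × ℕ

namespace NetCode

variable {K : ℕ}

/-- The width of a coded network. -/
abbrev width (c : NetCode K) : ℕ := c.1 + 3

/-- The index of the last layer of a coded network. -/
abbrev depth (c : NetCode K) : ℕ := c.2.1

/-- The shifted parameters of a coded network, in a single list. -/
abbrev params (c : NetCode K) : List (Fin (2 * K + 1)) := c.2.2.1

/-- The number of iterations after which a coded network is expected to halt. -/
abbrev time (c : NetCode K) : ℕ := c.2.2.2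

/-- The parameters of the neuron `i` of the layer `l`, as multiples of the resolution: the bias for
`j = 0`, and the weight of the neuron `j - 1` of the previous layer for `j > 0`. -/
def entry (c : NetCode K) (l i j : ℕ) : ℤ :=
  ((c.params.getD (Nat.pair l (Nat.pair i j)) ⟨K, by omega⟩ : Fin (2 * K + 1)) : ℕ) - (K : ℤ)

/-- The layers of a coded network, for the resolution `δ`. -/
noncomputable def layer (δ : ℝ) (c : NetCode K) (l : ℕ) : AffineLayer c.width c.width where
  weight i j := δ * c.entry l i (j + 1)
  bias i := δ * c.entry l i 0

/-- The coded network, for the resolution `δ`. -/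
noncomputable def net (δ : ℝ) (c : NetCode K) : LoopedNet :=
  ⟨c.width, Nat.le_add_left 3 c.1, FeedforwardNet.ofFn c.depth (c.layer δ)⟩

/-- The bias of a neuron plus the contributions of its first inputs, divided by the resolution, as a
polynomial in the resolution. -/
def partialSum (c : NetCode K) (l i : ℕ) (xs : List (List ℤ)) : ℕ → List ℤ
  | 0 => [c.entry l i 0]
  | j + 1 => listAdd (c.partialSum l i xs j) (listSmul (c.entry l i (j + 1)) (xs.getD j []))

/-- The value of a neuron before the activation, as a polynomial in the resolution. -/
def neuronVal (c : NetCode K) (l i : ℕ) (xs : List (List ℤ)) : List ℤ :=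
  0 :: c.partialSum l i xs c.width

variable (pos : List ℤ → Bool)

/-- The values of the neurons before a layer, as polynomials in the resolution whose signs are
decided by `pos`. -/
def hiddenVals (c : NetCode K) (xs : List (List ℤ)) : ℕ → List (List ℤ)
  | 0 => xs
  | l + 1 => (List.range c.width).map fun i =>
      bif pos (c.neuronVal l i (c.hiddenVals xs l)) then c.neuronVal l i (c.hiddenVals xs l) else []

/-- The states of a coded network, as polynomials in the resolution. -/
def stateVals (c : NetCode K) : ℕ → List (List ℤ)
  | 0 => []
  | t + 1 => (List.range c.width).map fun i =>
      c.neuronVal c.depth i (c.hiddenVals pos (c.stateVals t) c.depth)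

/-- Whether the coordinate `i` of the state is positive. -/
def channel (c : NetCode K) (t i : ℕ) : Bool := pos ((c.stateVals pos t).getD i [])

/-- The bits appended to the output by a coded network during the first iterations. -/
def emittedVals (c : NetCode K) : ℕ → List Bool
  | 0 => []
  | t + 1 => bif c.channel pos (t + 1) 1 then c.emittedVals t ++ [c.channel pos (t + 1) 2]
      else c.emittedVals t

/-- Whether a coded network does not halt during the first iterations. -/
def runs (c : NetCode K) : ℕ → Bool
  | 0 => true
  | t + 1 => c.runs t && !c.channel pos (t + 1) 0

/-- The number of non-zero parameters of a coded network. -/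
def count (c : NetCode K) : ℕ :=
  ∑ l ∈ Finset.range (c.depth + 1), ∑ i ∈ Finset.range c.width, ∑ j ∈ Finset.range (c.width + 1),
    bif decide (c.entry l i j = 0) then 0 else 1

/-- Whether a coded network outputs the string `s`, halting at the iteration `c.time + 1`. -/
def outputs (c : NetCode K) (s : List Bool) : Bool :=
  c.channel pos (c.time + 1) 0 && (c.runs pos c.time && decide (c.emittedVals pos c.time = s))

/-- The number of non-zero parameters of a coded network, or `∞` if it fails to output `s` at the
expected time. -/
def score (s : List Bool) (c : NetCode K) : Option ℕ :=
  bif c.outputs pos s then some c.count else none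

section Computability

variable {pos} {α : Type*} [Primcodable α] {c : α → NetCode K} {l i j t : α → ℕ}
  {xs : α → List (List ℤ)}

theorem computable_width (hc : Computable c) : Computable fun a => (c a).width :=
  Primrec.nat_add.to_comp.comp (Computable.fst.comp hc) (.const 3)

theorem computable_depth (hc : Computable c) : Computable fun a => (c a).depth :=
  Computable.fst.comp (Computable.snd.comp hc)

theorem computable_params (hc : Computable c) : Computable fun a => (c a).params :=
  Computable.fst.comp (Computable.snd.comp (Computable.snd.comp hc))

theorem computable_time (hc : Computable c) : Computable fun a => (c a).time :=
  Computable.snd.comp (Computable.snd.comp (Computable.snd.comp hc))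

theorem computable_entry (hc : Computable c) (hl : Computable l) (hi : Computable i)
    (hj : Computable j) : Computable fun a => (c a).entry (l a) (i a) (j a) := by
  have address := Primrec₂.natPair.to_comp.comp hl (Primrec₂.natPair.to_comp.comp hi hj)
  have digit := (Primrec.list_getD (⟨K, by omega⟩ : Fin (2 * K + 1))).to_comp.comp
    (computable_params hc) address
  exact (Primrec.dom_finite fun w : Fin (2 * K + 1) => ((w : ℕ) : ℤ) - (K : ℤ)).to_comp.comp digit

theorem computable_getD (hxs : Computable xs) (hi : Computable i) :
    Computable fun a => (xs a).getD (i a) [] := (Primrec.list_getD []).to_comp.comp hxs hi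

theorem computable_partialSum (hc : Computable c) (hl : Computable l) (hi : Computable i)
    (hxs : Computable xs) (hj : Computable j) :
    Computable fun a => (c a).partialSum (l a) (i a) (xs a) (j a) := by
  refine computable_of_recursion (F := fun a => (c a).partialSum (l a) (i a) (xs a))
    (h := fun a y => listAdd y.2
      (listSmul ((c a).entry (l a) (i a) (y.1 + 1)) ((xs a).getD y.1 []))) ?_ (fun _ _ => rfl) ?_ hj
  · exact Computable.list_cons.comp (computable_entry hc hl hi (.const 0)) (.const [])
  · have index : Computable fun z : α × ℕ × List ℤ => z.2.1 := Computable.fst.comp .snd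
    exact primrec₂_listAdd.to_comp.comp (Computable.snd.comp .snd)
      (primrec₂_listSmul.to_comp.comp
        (computable_entry (hc.comp .fst) (hl.comp .fst) (hi.comp .fst) (Computable.succ.comp index))
        (computable_getD (hxs.comp .fst) index))

theorem computable_neuronVal (hc : Computable c) (hl : Computable l) (hi : Computable i)
    (hxs : Computable xs) : Computable fun a => (c a).neuronVal (l a) (i a) (xs a) :=
  Computable.list_cons.comp (.const 0) (computable_partialSum hc hl hi hxs (computable_width hc))

theorem computable_hiddenVals (hpos : Computable pos) (hc : Computable c) (hxs : Computable xs)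
    (hl : Computable l) : Computable fun a => (c a).hiddenVals pos (xs a) (l a) := by
  refine computable_of_recursion (F := fun a => (c a).hiddenVals pos (xs a))
    (h := fun a y => (List.range (c a).width).map fun i =>
      bif pos ((c a).neuronVal y.1 i y.2) then (c a).neuronVal y.1 i y.2 else [])
    hxs (fun _ _ => rfl) ?_ hl
  have neuron : Computable fun z : (α × ℕ × List (List ℤ)) × ℕ =>
      (c z.1.1).neuronVal z.1.2.1 z.2 z.1.2.2 :=
    computable_neuronVal (hc.comp (Computable.fst.comp .fst))
      (Computable.fst.comp (Computable.snd.comp .fst)) .snd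
      (Computable.snd.comp (Computable.snd.comp .fst))
  exact computable_map_range (computable_width (hc.comp .fst))
    (Computable.cond (hpos.comp neuron) neuron (.const [])).to₂

theorem computable_stateVals (hpos : Computable pos) (hc : Computable c) (ht : Computable t) :
    Computable fun a => (c a).stateVals pos (t a) := by
  refine computable_of_recursion (F := fun a => (c a).stateVals pos)
    (h := fun a y => (List.range (c a).width).map fun i =>
      (c a).neuronVal (c a).depth i ((c a).hiddenVals pos y.2 (c a).depth))
    (.const []) (fun _ _ => rfl) ?_ ht
  have code : Computable fun z : (α × ℕ × List (List ℤ)) × ℕ => c z.1.1 :=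
    hc.comp (Computable.fst.comp .fst)
  exact computable_map_range (computable_width (hc.comp .fst))
    (computable_neuronVal code (computable_depth code) .snd
      (computable_hiddenVals hpos code (Computable.snd.comp (Computable.snd.comp .fst))
        (computable_depth code))).to₂

theorem computable_channel (hpos : Computable pos) (hc : Computable c) (ht : Computable t)
    (hi : Computable i) : Computable fun a => (c a).channel pos (t a) (i a) :=
  hpos.comp (computable_getD (computable_stateVals hpos hc ht) hi)

theorem computable_emittedVals (hpos : Computable pos) (hc : Computable c) (ht : Computable t) :
    Computable fun a => (c a).emittedVals pos (t a) := by
  refine computable_of_recursion (F := fun a => (c a).emittedVals pos)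
    (h := fun a y => bif (c a).channel pos (y.1 + 1) 1 then
      y.2 ++ [(c a).channel pos (y.1 + 1) 2] else y.2) (.const []) (fun _ _ => rfl) ?_ ht
  have output : Computable fun z : α × ℕ × List Bool => z.2.2 := Computable.snd.comp .snd
  have channel (i : ℕ) :
      Computable fun z : α × ℕ × List Bool => (c z.1).channel pos (z.2.1 + 1) i :=
    computable_channel hpos (hc.comp .fst) (Computable.succ.comp (Computable.fst.comp .snd))
      (.const i)
  exact Computable.cond (channel 1) (Computable.list_concat.comp output (channel 2)) output

theorem computable_runs (hpos : Computable pos) (hc : Computable c) (ht : Computable t) :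
    Computable fun a => (c a).runs pos (t a) :=
  computable_of_recursion (F := fun a => (c a).runs pos)
    (h := fun a y => y.2 && !(c a).channel pos (y.1 + 1) 0) (.const true) (fun _ _ => rfl)
    (Primrec.and.to_comp.comp (Computable.snd.comp .snd) (Primrec.not.to_comp.comp
      (computable_channel hpos (hc.comp .fst) (Computable.succ.comp (Computable.fst.comp .snd))
        (.const 0)))) ht

theorem computable_count (hc : Computable c) : Computable fun a => (c a).count := by
  have code : Computable fun z : ((α × ℕ) × ℕ) × ℕ => c z.1.1.1 :=
    hc.comp (Computable.fst.comp (Computable.fst.comp .fst))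
  have parameter := computable_entry code (Computable.snd.comp (Computable.fst.comp .fst))
    (Computable.snd.comp .fst) .snd
  have summand := Computable.cond ((PrimrecRel.decide Primrec.eq).to_comp.comp parameter (.const 0))
    (.const 0) (.const 1)
  have sum_inputs := computable_sum_range
    (Computable.succ.comp (computable_width (hc.comp (Computable.fst.comp .fst)))) summand.to₂
  have sum_neurons := computable_sum_range (computable_width (hc.comp .fst)) sum_inputs.to₂
  exact computable_sum_range (Computable.succ.comp (computable_depth hc)) sum_neurons.to₂

theorem computable_score (hpos : Computable pos) :
    Computable₂ fun (s : List Bool) (c : NetCode K) => c.score pos s := by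
  have time : Computable fun z : List Bool × NetCode K => z.2.time := computable_time .snd
  have halts := computable_channel hpos .snd (Computable.succ.comp time) (.const 0)
  have emits := (PrimrecRel.decide Primrec.eq).to_comp.comp
    (computable_emittedVals hpos .snd time) .fst
  exact Computable.cond (Primrec.and.to_comp.comp halts
      (Primrec.and.to_comp.comp (computable_runs hpos .snd time) emits))
    (Computable.option_some.comp (computable_count .snd)) (.const none)

end Computability

section Correctness

open Polynomial

variable {δ : ℝ} {pos : List ℤ → Bool}

/-- The vector `x` consists of the values at `δ` of a list of polynomials; indices beyond the end of
the list stand for the zero polynomial. -/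
def Represents (δ : ℝ) {D : ℕ} (xs : List (List ℤ)) (x : Fin D → ℝ) : Prop :=
  ∀ j : Fin D, aeval δ (listPoly (xs.getD j [])) = x j

theorem represents_map_range {D : ℕ} {f : ℕ → List ℤ} {x : Fin D → ℝ}
    (h : ∀ i : Fin D, aeval δ (listPoly (f i)) = x i) :
    Represents δ ((List.range D).map f) x := fun j => by
  rw [List.getD_eq_getElem _ _ (by simp), List.getElem_map, List.getElem_range, h]

theorem aeval_partialSum (c : NetCode K) (l i : ℕ) (xs : List (List ℤ)) (k : ℕ) :
    aeval δ (listPoly (c.partialSum l i xs k)) = c.entry l i 0 +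
      ∑ j ∈ Finset.range k, c.entry l i (j + 1) * aeval δ (listPoly (xs.getD j [])) := by
  induction k with
  | zero => simp [partialSum, listPoly]
  | succ k ih =>
    rw [partialSum, listPoly_listAdd, map_add, ih, Finset.sum_range_succ, listPoly_listSmul,
      map_mul, ← add_assoc]
    simp

theorem aeval_neuronVal (c : NetCode K) (l : ℕ) (i : Fin c.width) {xs : List (List ℤ)}
    {x : Fin c.width → ℝ} (hx : Represents δ xs x) :
    aeval δ (listPoly (c.neuronVal l i xs)) = (c.layer δ l).eval x i := by
  have eval_layer : (c.layer δ l).eval x i =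
    ∑ j : Fin c.width, δ * c.entry l i (j + 1) * x j + δ * c.entry l i 0 := rfl
  rw [eval_layer, neuronVal, listPoly_cons, C_0, zero_add, map_mul, aeval_X, aeval_partialSum,
    Finset.sum_range, mul_add, Finset.mul_sum, add_comm]
  simp only [hx _, mul_assoc]

variable (hpos : ∀ p, pos p = true ↔ 0 < aeval δ (listPoly p))
include hpos

theorem aeval_bif_pos (p : List ℤ) :
    aeval δ (listPoly (bif pos p then p else [])) = max (aeval δ (listPoly p)) 0 := by
  cases h : pos p with
  | true => exact (max_eq_left ((hpos p).1 h).le).symm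
  | false =>
    rw [max_eq_right (by rw [← not_lt, ← hpos, h]; exact Bool.false_ne_true)]
    simp [listPoly]

theorem represents_hiddenVals (c : NetCode K) {xs : List (List ℤ)} {x : Fin c.width → ℝ}
    (hx : Represents δ xs x) (l : ℕ) :
    Represents δ (c.hiddenVals pos xs l) (FeedforwardNet.hiddenState (c.layer δ) x l) := by
  induction l with
  | zero => exact hx
  | succ l ih =>
    exact represents_map_range fun i => by
      rw [aeval_bif_pos hpos, aeval_neuronVal c l i ih, FeedforwardNet.hiddenState]

theorem represents_stateVals (c : NetCode K) (t : ℕ) :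
    Represents δ (c.stateVals pos t) ((c.net δ).state t) := by
  induction t with
  | zero => exact fun _ => map_zero _
  | succ t ih =>
    rw [LoopedNet.state_succ, net, FeedforwardNet.eval_ofFn]
    exact represents_map_range fun i => aeval_neuronVal c _ i (represents_hiddenVals hpos c ih _)

theorem channel_eq_true_iff (c : NetCode K) (t : ℕ) (i : Fin c.width) :
    c.channel pos t i = true ↔ 0 < (c.net δ).state t i := by
  rw [channel, hpos, represents_stateVals hpos c t i]

theorem emittedVals_eq (c : NetCode K) (t : ℕ) : c.emittedVals pos t = (c.net δ).emitted t := by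
  induction t with
  | zero => rfl
  | succ t ih =>
    have emit_iff : c.channel pos (t + 1) 1 = true ↔ 0 < (c.net δ).emit (t + 1) :=
      channel_eq_true_iff hpos c (t + 1) ⟨1, Nat.lt_add_left c.1 (by norm_num)⟩
    have bit_eq : c.channel pos (t + 1) 2 = decide (0 < (c.net δ).bit (t + 1)) :=
      Bool.eq_iff_iff.2
        ((channel_eq_true_iff hpos c (t + 1) ⟨2, Nat.lt_add_left c.1 (by norm_num)⟩).trans
          decide_eq_true_iff.symm)
    rw [emittedVals, ih, bit_eq, LoopedNet.emitted, Bool.cond_eq_ite]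
    simp only [emit_iff]

theorem channel_zero_eq_true_iff (c : NetCode K) (t : ℕ) :
    c.channel pos t 0 = true ↔ 0 < (c.net δ).halt t :=
  channel_eq_true_iff hpos c t ⟨0, Nat.lt_add_left c.1 (by norm_num)⟩

theorem runs_eq_true_iff (c : NetCode K) (t : ℕ) :
    c.runs pos t = true ↔ ∀ u, 1 ≤ u → u ≤ t → ¬ 0 < (c.net δ).halt u := by
  induction t with
  | zero => exact iff_of_true rfl fun u _ _ => by omega
  | succ t ih =>
    rw [runs, Bool.and_eq_true, ih, Bool.not_eq_true', ← Bool.not_eq_true,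
      channel_zero_eq_true_iff hpos]
    refine ⟨fun h u hu hut => ?_, fun h =>
      ⟨fun u hu hut => h u hu (by omega), h _ (by omega) le_rfl⟩⟩
    rcases hut.lt_or_eq with hlt | rfl
    exacts [h.1 u hu (by omega), h.2]

theorem score_eq_some_iff {c : NetCode K} {s : List Bool} {k : ℕ} :
    c.score pos s = some k ↔ (0 < (c.net δ).halt (c.time + 1) ∧
      (∀ t, 1 ≤ t → t ≤ c.time → ¬ 0 < (c.net δ).halt t) ∧ (c.net δ).emitted c.time = s) ∧
        c.count = k := by
  simp only [score, outputs, Bool.cond_eq_ite, Option.ite_none_right_eq_some, Bool.and_eq_true,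
    decide_eq_true_iff, Option.some.injEq, channel_zero_eq_true_iff hpos, runs_eq_true_iff hpos,
    emittedVals_eq hpos]

omit hpos

theorem count_eq (hδ : δ ≠ 0) (c : NetCode K) : c.count = (c.net δ).block.numNonzero := by
  rw [net, FeedforwardNet.numNonzero_ofFn, count]
  refine Finset.sum_congr rfl fun l _ => ?_
  rw [AffineLayer.numNonzero, Finset.card_filter, Finset.card_filter, Fintype.sum_prod_type,
    ← Finset.sum_add_distrib, Finset.sum_range]
  refine Finset.sum_congr rfl fun i _ => ?_
  rw [Finset.sum_range_succ', Finset.sum_range]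
  simp [layer, hδ, Bool.cond_eq_ite]

variable {M : ℝ}

theorem isFixedPrecision_net (hδ : 0 < δ) (hM : δ ≤ M) (c : NetCode ⌊M / δ⌋₊) :
    (c.net δ).block.IsFixedPrecision δ M := by
  refine FeedforwardNet.isFixedPrecision_ofFn.2 fun l _ => ⟨fun i j => ?_, fun i => ?_⟩ <;>
    exact (mem_fixedPrecisionValues_iff hδ hM).2 ⟨_, rfl⟩

theorem exists_params_entry_eq (m n τ : ℕ) (f : ℕ → ℕ → ℕ → Fin (2 * K + 1)) :
    ∃ digits : List (Fin (2 * K + 1)), ∀ l ≤ n, ∀ i < m + 3, ∀ j < m + 4,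
      entry (K := K) (m, n, digits, τ) l i j = ((f l i j : ℕ) : ℤ) - (K : ℤ) := by
  refine ⟨(List.range (Nat.pair (n + 1) (Nat.pair (m + 3) (m + 4)))).map fun q =>
    f q.unpair.1 q.unpair.2.unpair.1 q.unpair.2.unpair.2, fun l hl i hi j hj => ?_⟩
  have address_lt : Nat.pair l (Nat.pair i j) < Nat.pair (n + 1) (Nat.pair (m + 3) (m + 4)) :=
    (Nat.pair_lt_pair_left _ (by omega)).trans (Nat.pair_lt_pair_right _
      ((Nat.pair_lt_pair_left _ hi).trans (Nat.pair_lt_pair_right _ hj)))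
  rw [entry, params, List.getD_eq_getElem _ _ (by simpa using address_lt)]
  simp

theorem exists_digits_of_isFixedPrecision (hδ : 0 < δ) (hM : δ ≤ M) {D : ℕ} {A : AffineLayer D D}
    (hA : A.IsFixedPrecision δ M) : ∃ f : ℕ → ℕ → Fin (2 * ⌊M / δ⌋₊ + 1),
      (∀ i j : Fin D, A.weight i j = δ * (((f i (j + 1) : ℕ) : ℤ) - (⌊M / δ⌋₊ : ℤ) : ℤ)) ∧
        ∀ i : Fin D, A.bias i = δ * (((f i 0 : ℕ) : ℤ) - (⌊M / δ⌋₊ : ℤ) : ℤ) := by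
  choose w hw using fun i j => (mem_fixedPrecisionValues_iff hδ hM).1 (hA.1 i j)
  choose b hb using fun i => (mem_fixedPrecisionValues_iff hδ hM).1 (hA.2 i)
  refine ⟨fun i j => if hi : i < D then
    (if hj : 0 < j ∧ j - 1 < D then w ⟨i, hi⟩ ⟨j - 1, hj.2⟩ else b ⟨i, hi⟩) else 0,
    fun i j => ?_, fun i => ?_⟩
  · simpa using hw i j
  · simpa using hb i

theorem exists_layer_eq (hδ : 0 < δ) (hM : δ ≤ M) (m n τ : ℕ)
    {A : ℕ → AffineLayer (m + 3) (m + 3)} (hA : ∀ l ≤ n, (A l).IsFixedPrecision δ M) :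
    ∃ digits : List (Fin (2 * ⌊M / δ⌋₊ + 1)), ∀ l ≤ n, layer δ (m, n, digits, τ) l = A l := by
  choose! f weight_eq bias_eq using fun l hl =>
    exists_digits_of_isFixedPrecision hδ hM (hA l hl)
  obtain ⟨digits, entry_eq⟩ := exists_params_entry_eq m n τ f
  refine ⟨digits, fun l hl => congrArg₂ AffineLayer.mk ?_ ?_⟩
  · ext i j
    rw [entry_eq l hl i i.2 _ (Nat.succ_lt_succ j.2), weight_eq l hl]
  · ext i
    rw [entry_eq l hl i i.2 _ (Nat.succ_pos _), bias_eq l hl]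

theorem neuralComplexity_le_score (hδ : 0 < δ) (hM : δ ≤ M)
    (hpos : ∀ p, pos p = true ↔ 0 < aeval δ (listPoly p)) (s : List Bool)
    (c : NetCode ⌊M / δ⌋₊) : neuralComplexity δ M s ≤ extNat (c.score pos s) := by
  cases h : c.score pos s with
  | none => exact le_top
  | some k =>
    obtain ⟨hout, rfl⟩ := (score_eq_some_iff hpos).1 h
    exact neuralComplexity_le_iff.2 ⟨c.net δ, isFixedPrecision_net hδ hM c, ⟨_, hout⟩,
      (count_eq hδ.ne' c).ge⟩

theorem exists_score_le (hδ : 0 < δ) (hM : δ ≤ M)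
    (hpos : ∀ p, pos p = true ↔ 0 < aeval δ (listPoly p)) {s : List Bool} {m : ℕ}
    (h : neuralComplexity δ M s ≤ m) :
    ∃ c : NetCode ⌊M / δ⌋₊, extNat (c.score pos s) ≤ m := by
  obtain ⟨N, hN, hout, hcard⟩ := neuralComplexity_le_iff.1 h
  obtain ⟨A, hA, hle, hA_out⟩ := N.exists_ofFn (hδ.le.trans hM) hN hcard
  obtain ⟨τ, hτ⟩ := hA_out s hout
  obtain ⟨digits, layer_eq⟩ :=
    exists_layer_eq hδ hM m N.block.depth τ (FeedforwardNet.isFixedPrecision_ofFn.1 hA)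
  let c : NetCode ⌊M / δ⌋₊ := (m, N.block.depth, digits, τ)
  have net_eq : c.net δ = ⟨m + 3, by omega, FeedforwardNet.ofFn N.block.depth A⟩ := by
    rw [net, FeedforwardNet.ofFn_congr layer_eq]
  rw [← net_eq] at hτ
  refine ⟨c, ?_⟩
  rw [(score_eq_some_iff hpos).2 ⟨hτ, rfl⟩, count_eq hδ.ne' c, net_eq]
  exact Nat.cast_le.2 (hle.trans hcard)

end Correctness

end NetCode

section Infimum

/-- The minimum on `Option ℕ`, with `none` standing for `∞`. -/
def optionMin (a b : Option ℕ) : Option ℕ :=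
  Option.casesOn a b fun m => Option.casesOn b (some m) fun n => some (min m n)

theorem computable₂_optionMin : Computable₂ optionMin := by
  have min_some := Computable.option_some.comp (Primrec.nat_min.to_comp.comp
    (Computable.snd.comp (Computable.fst (α := (Option ℕ × Option ℕ) × ℕ) (β := ℕ))) .snd)
  have some_left := Computable.option_casesOn
    (Computable.snd.comp (Computable.fst (α := Option ℕ × Option ℕ) (β := ℕ)))
    (Computable.option_some.comp .snd) min_some.to₂
  exact Computable.option_casesOn .fst .snd some_left.to₂

theorem extNat_optionMin : ∀ a b, extNat (optionMin a b) = min (extNat a) (extNat b)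
  | none, none => (min_self _).symm
  | none, some _ => (min_eq_right le_top).symm
  | some _, none => (min_eq_left le_top).symm
  | some _, some _ => Nat.mono_cast.map_min

/-- The minimum of the first terms of a sequence in `Option ℕ`, with `none` standing for `∞`. -/
def runningMin (f : ℕ → Option ℕ) : ℕ → Option ℕ
  | 0 => none
  | k + 1 => optionMin (runningMin f k) (f k)

theorem extNat_runningMin_succ (f : ℕ → Option ℕ) (k : ℕ) :
    extNat (runningMin f (k + 1)) = min (extNat (runningMin f k)) (extNat (f k)) :=
  extNat_optionMin _ _

theorem antitone_extNat_runningMin (f : ℕ → Option ℕ) :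
    Antitone fun k => extNat (runningMin f k) :=
  antitone_nat_of_succ_le fun k => (extNat_runningMin_succ f k).trans_le (min_le_left _ _)

theorem iInf_extNat_runningMin (f : ℕ → Option ℕ) :
    ⨅ k, extNat (runningMin f k) = ⨅ k, extNat (f k) := by
  refine le_antisymm (le_iInf fun k => (iInf_le _ (k + 1)).trans
    ((extNat_runningMin_succ f k).trans_le (min_le_right _ _))) (le_iInf fun k => ?_)
  induction k with
  | zero => exact le_top
  | succ k ih =>
    rw [extNat_runningMin_succ]
    exact le_min ih (iInf_le _ k)

theorem isUpperSemicomputable_iInf_nat {f : List Bool → ℕ → Option ℕ} (hf : Computable₂ f) :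
    IsUpperSemicomputable fun s => ⨅ k, extNat (f s k) := by
  refine ⟨fun s => runningMin (f s), ?_, fun s => ⟨antitone_extNat_runningMin _, ?_⟩⟩
  · exact computable_of_recursion (F := fun y : List Bool × ℕ => runningMin (f y.1))
      (h := fun y z => optionMin z.2 (f y.1 z.1)) (.const none) (fun _ _ => rfl)
      (computable₂_optionMin.comp (Computable.snd.comp .snd)
        (hf.comp (Computable.fst.comp .fst) (Computable.fst.comp .snd))) .snd
  · change Filter.Tendsto (fun k => extNat (runningMin (f s) k)) Filter.atTop
      (nhds (⨅ k, extNat (f s k)))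
    rw [← iInf_extNat_runningMin]
    exact tendsto_atTop_iInf (antitone_extNat_runningMin _)

theorem isUpperSemicomputable_iInf {β : Type*} [Primcodable β] {f : List Bool → β → Option ℕ}
    (hf : Computable₂ f) : IsUpperSemicomputable fun s => ⨅ b, extNat (f s b) := by
  have iInf_decode (s : List Bool) :
      ⨅ n, extNat ((Encodable.decode n : Option β).bind (f s)) = ⨅ b, extNat (f s b) := by
    refine le_antisymm (le_iInf fun b => (iInf_le _ (Encodable.encode b)).trans_eq ?_)
      (le_iInf fun n => ?_)
    · rw [Encodable.encodek, Option.bind_some]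
    · cases (Encodable.decode n : Option β) with
      | none => exact le_top
      | some b => exact iInf_le _ b
  simp only [← iInf_decode]
  exact isUpperSemicomputable_iInf_nat (Computable.option_bind (Computable.decode.comp .snd)
    (hf.comp (Computable.fst.comp .fst) .snd))

end Infimum

theorem isUpperSemicomputable_neuralComplexity {δ M : ℝ} (hδ : 0 < δ) (hM : δ ≤ M)
    (hc : IsComputableReal δ) : IsUpperSemicomputable (neuralComplexity δ M) := by
  obtain ⟨pos, computable_pos, hpos⟩ := exists_computable_pos hδ.le hc
  convert isUpperSemicomputable_iInf
    (NetCode.computable_score (K := ⌊M / δ⌋₊) computable_pos) using 2 with s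
  refine le_antisymm (le_iInf fun c => NetCode.neuralComplexity_le_score hδ hM hpos s c) ?_
  cases h : neuralComplexity δ M s with
  | top => exact le_top
  | coe m =>
    obtain ⟨c, hc⟩ := NetCode.exists_score_le hδ hM hpos h.le
    exact (iInf_le _ c).trans hc

theorem mainTheorem6 (δ M : ℝ) (hδ : 0 < δ) (hM : δ ≤ M) :
    (IsComputableReal δ → IsUpperSemicomputable (neuralComplexity δ M)) ∧
      ¬ IsComputableENat (neuralComplexity δ M) :=
  ⟨isUpperSemicomputable_neuralComplexity hδ hM, not_isComputableENat_neuralComplexity hδ hM⟩
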